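/- Let $q \ge 2$ be real and let $q^*$ be its dual exponent, defined by $\frac1q + \frac1{q^*} = 1$. Let $p \ge 1$ be real and let $\mu_p$ be the probability measure $d\mu_p(x) = Z_p^{-1} e^{-|x|^p}\,dx$ on $\mathbb{R}$, where $Z_p = \int_{\mathbb{R}} e^{-|x|^p}\,dx$. Put $H_q(t) = \max(t^2, |t|^q)$ for $t \in \mathbb{R}$. For a probability measure $\mu$ on $\mathbb R$ and a measurable function $g \ge 0$, let $$\mathrm{Ent}_\mu(g) = \int g \log g \, d\mu - \Big(\int g\,d\mu\Big) \log\Big(\int g\,d\mu\Big) \in [0,+\infty],$$ with $0\log 0=0$ and with $\mathrm{Ent}_\mu(g) = +\infty$ if $\int g\,d\mu = +\infty$. Then there exists a constant $C_{p,q} \in (0,+\infty)$ such that every locally Lipschitz function $f : \mathbb{R} \to \mathbb{R}$ satisfies $$\mathrm{Ent}_{\mu_p}(f^2) \le C_{p,q} \int_{\mathbb{R}} H_q\Big(\frac{f'}{f}\Big) f^2 \, d\mu_p$$ if and only if $p \ge q^*$. Here $f'$ is the almost everywhere defined derivative of $f$, the integral on the right takes values in $[0,+\infty]$, and its integrand is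 $0$ where $f = 0$ (almost everywhere on that set $f' = 0$). -/

import Mathlib

open MeasureTheory
open scoped ENNReal

noncomputable section

/-- The function `H_q(t) = max (t ^ 2) (|t| ^ q)`. -/
def modPow (q t : ℝ) : ℝ := max (t ^ 2) (|t| ^ q)

/-- The normalising constant `Z_p = ∫ exp (-|x| ^ p) dx`. -/
def expPowConst (p : ℝ) : ℝ := ∫ x : ℝ, Real.exp (-|x| ^ p)

/-- The measure `dμ_p(x) = Z_p⁻¹ exp (-|x| ^ p) dx` on the real line. -/
def expPowMeasure (p : ℝ) : Measure ℝ :=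
  volume.withDensity fun x => ENNReal.ofReal ((expPowConst p)⁻¹ * Real.exp (-|x| ^ p))

open Classical in
/-- The entropy `∫ g log g dμ - (∫ g dμ) log (∫ g dμ)` of a nonnegative function `g` with respect
to a probability measure, as an extended number. When `g` is integrable, the negative part of
`g log g` is bounded by `1 / e`, so that `∫ g log g dμ` makes sense in `(-∞, +∞]`, as the difference
of the integrals of the positive and negative parts. When `∫ g dμ = +∞` the entropy is `+∞`. -/
def entropy (μ : Measure ℝ) (g : ℝ → ℝ) : EReal :=
  if Integrable g μ then
    ((∫⁻ x, ENNReal.ofReal (g x * Real.log (g x)) ∂μ : ℝ≥0∞) : EReal)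
      - ((∫⁻ x, ENNReal.ofReal (-(g x * Real.log (g x))) ∂μ : ℝ≥0∞) : EReal)
      - (((∫ x, g x ∂μ) * Real.log (∫ x, g x ∂μ) : ℝ) : EReal)
  else ⊤

/-- The `[0, +∞]`-valued energy `∫ H (f' / f) f ^ 2 dμ`. A locally Lipschitz `f` is differentiable
almost everywhere, with `f' = 0` almost everywhere on `{f = 0}`; the integrand is `0` there. -/
def modEnergy (H : ℝ → ℝ) (μ : Measure ℝ) (f : ℝ → ℝ) : ℝ≥0∞ :=
  ∫⁻ x, ENNReal.ofReal (H (deriv f x / f x) * f x ^ 2) ∂μ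

/-- The modified logarithmic Sobolev inequality with function `H`: for some finite constant `κ`,
every locally Lipschitz `f` satisfies `Ent_μ (f ^ 2) ≤ κ ∫ H (f' / f) f ^ 2 dμ`. -/
def ModifiedLogSobolev (H : ℝ → ℝ) (μ : Measure ℝ) : Prop :=
  ∃ κ : ℝ, 0 < κ ∧ ∀ f : ℝ → ℝ, LocallyLipschitz f →
    entropy μ (fun x => f x ^ 2) ≤ ((ENNReal.ofReal κ * modEnergy H μ f : ℝ≥0∞) : EReal)

end

/-!
Let `ρ` be the density of `μ_p` and suppose `q* ≤ p`. For `u ≥ 0`, integrate the derivative of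
`x u ρ`, namely `(u + x u' - p |x| ^ p u) ρ`, over the line. By Young's inequality `x u'` is at most
`|x| ^ q* u / q*` plus a multiple of the energy density `|u'| ^ q / u ^ (q - 1)`; the first part is
absorbed in `p |x| ^ p u`, so the moment `∫ |x| ^ p u dμ_p` is controlled by `∫ u dμ_p` and the
energy. Hence so is `∫ |(u ρ)'|`, which bounds `u ρ` uniformly; as `-log ρ` is `|x| ^ p` up to a
constant, `∫ u log u dμ_p` obeys a defective inequality.

Applied to a smooth truncation `u` of `f ^ 2` that vanishes where `f ^ 2 ≤ 4`, with `∫ f ^ 2 = 1`,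
this becomes tight: `∫ u` and the entropy of the discarded part are both bounded by multiples of
`∫ (|f| - 1) ^ 2`, because `y log y - y + 1` is quadratic near `y = 1`, and the Hardy inequality
bounds this integral by `∫ f' ^ 2`.

If `p < q*`, take `f ^ 2 ρ` to be `x ^ (-(1 + p))` near `+∞`. The entropy is infinite, since
`-log ρ ~ x ^ p`, but `f' / f` has order at most `x ^ max (p - 1) 0` and `(p - 1) q < p`, so the
energy is finite.
-/

section Calculus

open Set Filter Topology

theorem abs_intervalIntegral_le_integral_abs {g : ℝ → ℝ} (hg : Integrable g) (a b : ℝ) :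
    |∫ x in a..b, g x| ≤ ∫ x, |g x| :=
  intervalIntegral.norm_integral_le_integral_norm_uIoc.trans
    (setIntegral_le_integral hg.norm (.of_forall fun x => norm_nonneg (g x)))

/-- Absolute continuity on every compact interval: the regularity under which the fundamental
theorem of calculus holds on each of them. Locally Lipschitz functions have it, and unlike
differentiability everywhere it is kept by truncation. -/
def LocallyAbsolutelyContinuous (f : ℝ → ℝ) : Prop :=
  ∀ a b, AbsolutelyContinuousOnInterval f a b

namespace LocallyAbsolutelyContinuous

variable {f g : ℝ → ℝ}

theorem of_locallyLipschitz (hf : LocallyLipschitz f) : LocallyAbsolutelyContinuous f := by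
  intro a b
  obtain ⟨K, hK⟩ := hf.locallyLipschitzOn.exists_lipschitzOnWith_of_compact
    (isCompact_uIcc (a := a) (b := b))
  exact hK.absolutelyContinuousOnInterval

theorem of_contDiff (hf : ContDiff ℝ 1 f) : LocallyAbsolutelyContinuous f :=
  of_locallyLipschitz (hf.locallyLipschitz (𝕂 := ℝ))

theorem of_hasDerivAt {f' : ℝ → ℝ} (hf : ∀ x, HasDerivAt f (f' x) x) (hf' : Continuous f') :
    LocallyAbsolutelyContinuous f := by
  refine of_contDiff (contDiff_one_iff_deriv.2 ⟨fun x => (hf x).differentiableAt, ?_⟩)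
  rwa [show deriv f = f' from funext fun x => (hf x).deriv]

theorem mul (hf : LocallyAbsolutelyContinuous f) (hg : LocallyAbsolutelyContinuous g) :
    LocallyAbsolutelyContinuous fun x => f x * g x :=
  fun a b => (hf a b).fun_mul (hg a b)

theorem const_mul (c : ℝ) (hf : LocallyAbsolutelyContinuous f) :
    LocallyAbsolutelyContinuous fun x => c * f x :=
  fun a b => (hf a b).const_mul c

theorem sub_const (hf : LocallyAbsolutelyContinuous f) (c : ℝ) :
    LocallyAbsolutelyContinuous fun x => f x - c :=
  fun a b => (hf a b).fun_sub (of_contDiff contDiff_const a b)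

theorem continuous (hf : LocallyAbsolutelyContinuous f) : Continuous f := by
  refine continuous_iff_continuousAt.2 fun x => ?_
  refine (hf (x - 1) (x + 1)).continuousOn.continuousAt ?_
  rw [uIcc_of_le (by linarith)]
  exact Icc_mem_nhds (by linarith) (by linarith)

theorem ae_differentiableAt (hf : LocallyAbsolutelyContinuous f) :
    ∀ᵐ x, DifferentiableAt ℝ f x := by
  have hball : ∀ n : ℕ, ∀ᵐ x, x ∈ uIcc (-(n : ℝ)) n → DifferentiableAt ℝ f x :=
    fun n => (hf _ _).ae_differentiableAt
  filter_upwards [ae_all_iff.2 hball] with x hx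
  obtain ⟨n, hn⟩ := exists_nat_ge |x|
  refine hx n ?_
  rw [uIcc_of_le (by linarith [abs_nonneg x])]
  exact abs_le.1 hn

theorem abs_sub_le_integral_abs_deriv (hf : LocallyAbsolutelyContinuous f)
    (hf' : Integrable (deriv f)) (x y : ℝ) : |f y - f x| ≤ ∫ t, |deriv f t| := by
  rw [← (hf x y).integral_deriv_eq_sub]
  exact abs_intervalIntegral_le_integral_abs hf' x y

-- Average `|f x| ≤ |f y| + ∫ |f'|` over `y ∈ [x, x + 1]`.
theorem abs_le_integral_abs_add_integral_abs_deriv (hf : LocallyAbsolutelyContinuous f)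
    (hfi : Integrable f) (hf' : Integrable (deriv f)) (x : ℝ) :
    |f x| ≤ (∫ t, |f t|) + ∫ t, |deriv f t| := by
  have hpoint : ∀ y, |f x| ≤ |f y| + ∫ t, |deriv f t| := fun y => by
    have := hf.abs_sub_le_integral_abs_deriv hf' y x
    linarith [abs_sub_abs_le_abs_sub (f x) (f y)]
  have hloc : IntervalIntegrable (fun y => |f y|) volume x (x + 1) :=
    hfi.abs.intervalIntegrable
  calc |f x| = ∫ _ in x..(x + 1), |f x| := by simp
    _ ≤ ∫ y in x..(x + 1), (|f y| + ∫ t, |deriv f t|) :=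
        intervalIntegral.integral_mono (by linarith) intervalIntegrable_const
          (hloc.add intervalIntegrable_const) hpoint
    _ = (∫ y in x..(x + 1), |f y|) + ∫ t, |deriv f t| := by
        rw [intervalIntegral.integral_add hloc intervalIntegrable_const]; simp
    _ ≤ (∫ t, |f t|) + ∫ t, |deriv f t| := by
        gcongr
        rw [intervalIntegral.integral_of_le (by linarith)]
        exact setIntegral_le_integral hfi.abs (.of_forall fun t => abs_nonneg (f t))

end LocallyAbsolutelyContinuous

theorem ae_deriv_eq_zero_of_eq {F : Type*} [NormedAddCommGroup F] [NormedSpace ℝ F] (f : ℝ → F)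
    (c : F) : ∀ᵐ x, f x = c → deriv f x = 0 := by
  have hisolated := countable_setOfPred_isolated_right_within (s := {x : ℝ | f x = c})
  filter_upwards [hisolated.ae_notMem volume] with x hx hfx
  by_contra hd
  refine hx ⟨hfx, ?_⟩
  have hne : ∀ᶠ z in 𝓝[≠] x, f z ≠ c :=
    (differentiableAt_of_deriv_ne_zero hd).hasDerivAt.eventually_ne hd
  have hle : 𝓝[{x | f x = c} ∩ Ioi x] x ≤ 𝓝[≠] x :=
    nhdsWithin_mono _ fun y hy => (ne_of_gt hy.2 : y ≠ x)
  rw [← eventually_false_iff_eq_bot]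
  filter_upwards [hle hne, self_mem_nhdsWithin] with z hz hz'
  exact hz hz'.1

theorem intervalIntegral_le_of_ae_deriv_add_le {Φ g h : ℝ → ℝ} {a b : ℝ} (hab : a ≤ b)
    (hΦ : AbsolutelyContinuousOnInterval Φ a b) (hΦab : Φ a ≤ Φ b)
    (hg : IntervalIntegrable g volume a b) (hh : IntervalIntegrable h volume a b)
    (hle : ∀ᵐ x, x ∈ Ioo a b → deriv Φ x + h x ≤ g x) :
    ∫ x in a..b, h x ≤ ∫ x in a..b, g x := by
  have hderiv : ∫ x in a..b, deriv Φ x ≤ ∫ x in a..b, (g x - h x) := by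
    refine intervalIntegral.integral_mono_ae_restrict hab hΦ.intervalIntegrable_deriv (hg.sub hh) ?_
    rw [← restrict_Ioo_eq_restrict_Icc]
    refine (ae_restrict_iff' measurableSet_Ioo).2 ?_
    filter_upwards [hle] with x hx hxab
    linarith [hx hxab]
  rw [hΦ.integral_deriv_eq_sub, intervalIntegral.integral_sub hg hh] at hderiv
  linarith

theorem integrable_and_integral_le_of_ae_deriv_add_le {Φ Ψ g h : ℝ → ℝ}
    (hΦ : LocallyAbsolutelyContinuous Φ) (hΦ0 : ∀ x, 0 ≤ x → Φ 0 ≤ Φ x)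
    (hΨ : LocallyAbsolutelyContinuous Ψ) (hΨ0 : ∀ x, x ≤ 0 → Ψ x ≤ Ψ 0)
    (hg : Integrable g) (hh : Continuous h) (hh0 : ∀ x, 0 ≤ h x)
    (hright : ∀ᵐ x, 0 < x → deriv Φ x + h x ≤ g x)
    (hleft : ∀ᵐ x, x < 0 → deriv Ψ x + h x ≤ g x) :
    Integrable h ∧ ∫ x, h x ≤ ∫ x, g x := by
  have hbound : ∀ R : ℝ, 0 ≤ R → ∫ x in (-R)..R, h x ≤ ∫ x in (-R)..R, g x := by
    intro R hR
    rw [← intervalIntegral.integral_add_adjacent_intervals (b := 0) (hh.intervalIntegrable _ _)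
        (hh.intervalIntegrable _ _),
      ← intervalIntegral.integral_add_adjacent_intervals (b := 0) hg.intervalIntegrable
        hg.intervalIntegrable]
    refine add_le_add ?_ ?_
    · exact intervalIntegral_le_of_ae_deriv_add_le (by linarith) (hΨ _ _) (hΨ0 _ (by linarith))
        hg.intervalIntegrable (hh.intervalIntegrable _ _) (hleft.mono fun x hx hxR => hx hxR.2)
    · exact intervalIntegral_le_of_ae_deriv_add_le hR (hΦ _ _) (hΦ0 R hR) hg.intervalIntegrable
        (hh.intervalIntegrable _ _) (hright.mono fun x hx hxR => hx hxR.1)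
  have hhi : Integrable h := by
    refine integrable_of_intervalIntegral_norm_bounded (l := atTop) (a := fun R : ℝ => -R)
      (b := id) (∫ x, |g x|) (fun R => hh.integrableOn_Ioc) tendsto_neg_atTop_atBot tendsto_id ?_
    filter_upwards [eventually_ge_atTop 0] with R hR
    simp only [Real.norm_of_nonneg (hh0 _), id]
    exact (hbound R hR).trans
      ((le_abs_self _).trans (abs_intervalIntegral_le_integral_abs hg _ _))
  have hlim : ∀ {k : ℝ → ℝ}, Integrable k →
      Tendsto (fun R : ℝ => ∫ x in (-R)..R, k x) atTop (𝓝 (∫ x, k x)) := fun hk =>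
    intervalIntegral_tendsto_integral hk tendsto_neg_atTop_atBot tendsto_id
  exact ⟨hhi, le_of_tendsto_of_tendsto (hlim hhi) (hlim hg)
    ((eventually_ge_atTop 0).mono hbound)⟩

end Calculus

section Hardy

open Set

variable {ρ : ℝ → ℝ}

theorem hasDerivAt_integral_Ioi (hρ : Continuous ρ) (hρi : Integrable ρ) (x : ℝ) :
    HasDerivAt (fun x => ∫ t in Ioi x, ρ t) (-ρ x) x := by
  have htail : (fun x => ∫ t in Ioi x, ρ t) = fun x => (∫ t in Ioi 0, ρ t) - ∫ t in 0..x, ρ t := by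
    ext y
    rw [← intervalIntegral.integral_Ioi_sub_Ioi' hρi.integrableOn hρi.integrableOn]
    ring
  rw [htail]
  exact (hρ.integral_hasStrictDerivAt 0 x).hasDerivAt.const_sub _

theorem hasDerivAt_integral_Iic (hρ : Continuous ρ) (hρi : Integrable ρ) (x : ℝ) :
    HasDerivAt (fun x => ∫ t in Iic x, ρ t) (ρ x) x := by
  have htail : (fun x => ∫ t in Iic x, ρ t) = fun x => (∫ t in Iic 0, ρ t) + ∫ t in 0..x, ρ t := by
    ext y
    rw [← intervalIntegral.integral_Iic_sub_Iic hρi.integrableOn hρi.integrableOn]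
    ring
  rw [htail]
  exact (hρ.integral_hasStrictDerivAt 0 x).hasDerivAt.const_add _

theorem four_mul_mul_le_of_abs_le {v w s r C : ℝ} (hr : 0 ≤ r) (hs : |s| ≤ C * r) :
    4 * (v * w * s) ≤ v ^ 2 * r + 4 * C ^ 2 * (w ^ 2 * r) := by
  have hsquare : 0 ≤ r * (|v| - 2 * C * |w|) ^ 2 := by positivity
  have habs : v * w * s ≤ |v| * |w| * (C * r) := by
    refine (le_abs_self _).trans ?_
    rw [abs_mul, abs_mul]
    gcongr
  rw [← sq_abs v, ← sq_abs w]
  linarith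

theorem deriv_sq_mul_add_le {f S : ℝ → ℝ} {x c C : ℝ} (hf : DifferentiableAt ℝ f x)
    (hS : HasDerivAt S (-ρ x) x) (hρ : 0 ≤ ρ x) (hSC : |S x| ≤ C * ρ x) :
    deriv (fun y => 2 * ((f y - c) * (f y - c) * S y)) x + (f x - c) ^ 2 * ρ x
      ≤ 4 * C ^ 2 * (deriv f x ^ 2 * ρ x) := by
  have hv := hf.hasDerivAt.sub_const c
  rw [(((hv.fun_mul hv).fun_mul hS).const_mul 2).deriv]
  linarith [four_mul_mul_le_of_abs_le (v := f x - c) (w := deriv f x) hρ hSC]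

theorem integrable_and_integral_sq_sub_mul_le {C : ℝ} (hρ : Continuous ρ) (hρi : Integrable ρ)
    (hρ0 : ∀ x, 0 ≤ ρ x) (hright : ∀ x, 0 ≤ x → ∫ t in Ioi x, ρ t ≤ C * ρ x)
    (hleft : ∀ x, x ≤ 0 → ∫ t in Iic x, ρ t ≤ C * ρ x) {f : ℝ → ℝ}
    (hf : LocallyAbsolutelyContinuous f) (hf' : Integrable fun x => deriv f x ^ 2 * ρ x) :
    Integrable (fun x => (f x - f 0) ^ 2 * ρ x) ∧
      ∫ x, (f x - f 0) ^ 2 * ρ x ≤ 4 * C ^ 2 * ∫ x, deriv f x ^ 2 * ρ x := by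
  have hIoi0 : ∀ x, 0 ≤ ∫ t in Ioi x, ρ t := fun x =>
    setIntegral_nonneg measurableSet_Ioi fun t _ => hρ0 t
  have hIic0 : ∀ x, 0 ≤ ∫ t in Iic x, ρ t := fun x =>
    setIntegral_nonneg measurableSet_Iic fun t _ => hρ0 t
  have hIoi' := hasDerivAt_integral_Ioi hρ hρi
  have hIic' : ∀ x, HasDerivAt (fun x => -∫ t in Iic x, ρ t) (-ρ x) x := fun x =>
    (hasDerivAt_integral_Iic hρ hρi x).fun_neg
  have hfc := hf.continuous
  have hLAC : ∀ {S : ℝ → ℝ}, (∀ x, HasDerivAt S (-ρ x) x) → LocallyAbsolutelyContinuous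
      fun x => 2 * ((f x - f 0) * (f x - f 0) * S x) := fun hS =>
    .const_mul 2 (((hf.sub_const _).mul (hf.sub_const _)).mul (.of_hasDerivAt hS hρ.neg))
  rw [← integral_const_mul]
  refine integrable_and_integral_le_of_ae_deriv_add_le (hLAC hIoi') (fun x _ => ?_)
    (hLAC hIic') (fun x _ => ?_) (hf'.const_mul _) (by fun_prop)
    (fun x => mul_nonneg (sq_nonneg _) (hρ0 x)) ?_ ?_
  · simpa using mul_nonneg (mul_self_nonneg (f x - f 0)) (hIoi0 x)
  · simpa using mul_nonneg (mul_self_nonneg (f x - f 0)) (hIic0 x)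
  · filter_upwards [hf.ae_differentiableAt] with x hx hx0
    refine deriv_sq_mul_add_le hx (hIoi' x) (hρ0 x) ?_
    rw [abs_of_nonneg (hIoi0 x)]
    exact hright x hx0.le
  · filter_upwards [hf.ae_differentiableAt] with x hx hx0
    refine deriv_sq_mul_add_le hx (hIic' x) (hρ0 x) ?_
    rw [abs_neg, abs_of_nonneg (hIic0 x)]
    exact hleft x hx0.le

end Hardy

section Variance

open ProbabilityTheory

theorem integral_sq_abs_sub_one_le {Ω : Type*} [MeasurableSpace Ω] {μ : Measure Ω}
    [IsProbabilityMeasure μ] {f : Ω → ℝ} (hf : MemLp f 2 μ) (hf1 : ∫ x, f x ^ 2 ∂μ = 1) (c : ℝ) :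
    ∫ x, (|f x| - 1) ^ 2 ∂μ ≤ 2 * ∫ x, (f x - c) ^ 2 ∂μ := by
  have hfabs : MemLp (fun x => |f x|) 2 μ := hf.abs
  have hi : Integrable (fun x => |f x|) μ := hfabs.integrable one_le_two
  have hi2 : Integrable (fun x => f x ^ 2) μ := hf.integrable_sq
  have hvar : variance (fun x => |f x|) μ = 1 - (∫ x, |f x| ∂μ) ^ 2 := by
    rw [variance_eq_sub hfabs]
    simp only [Pi.pow_apply, sq_abs, hf1]
  have hmean : 0 ≤ ∫ x, |f x| ∂μ := integral_nonneg fun x => abs_nonneg _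
  have hmean1 : ∫ x, |f x| ∂μ ≤ 1 := by
    have := variance_nonneg (fun x => |f x|) μ
    exact (sq_le_one_iff₀ hmean).1 (by linarith)
  have hvar_le : variance (fun x => |f x|) μ ≤ ∫ x, (f x - c) ^ 2 ∂μ := by
    rw [← variance_sub_const hfabs.aestronglyMeasurable |c|]
    refine (variance_le_expectation_sq (hi.sub (integrable_const _)).aestronglyMeasurable).trans ?_
    refine integral_mono (hfabs.sub (memLp_const _)).integrable_sq
      (hf.sub (memLp_const c)).integrable_sq fun x => ?_
    exact sq_le_sq.2 (abs_abs_sub_abs_le (f x) c)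
  calc ∫ x, (|f x| - 1) ^ 2 ∂μ = ∫ x, (f x ^ 2 - 2 * |f x| + 1) ∂μ := by
        congr with x; rw [← sq_abs (f x)]; ring
    _ = 2 * (1 - ∫ x, |f x| ∂μ) := by
        have hsub : Integrable (fun x => f x ^ 2 - 2 * |f x|) μ := hi2.sub (hi.const_mul 2)
        rw [integral_add hsub (integrable_const 1),
          integral_sub hi2 (hi.const_mul 2), integral_const_mul, hf1]
        simp; ring
    _ ≤ 2 * variance (fun x => |f x|) μ := by rw [hvar]; nlinarith
    _ ≤ 2 * ∫ x, (f x - c) ^ 2 ∂μ := by gcongr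

end Variance

section Density

open Set

variable {p : ℝ}

/-- The density of `expPowMeasure p` with respect to Lebesgue measure, as a real function. -/
noncomputable def expPowDensity (p x : ℝ) : ℝ := (expPowConst p)⁻¹ * Real.exp (-|x| ^ p)

theorem integrable_exp_neg_abs_rpow (hp : 0 < p) :
    Integrable fun x : ℝ => Real.exp (-|x| ^ p) := by
  refine Integrable.of_integral_ne_zero ?_
  rw [integral_comp_abs (f := fun x => Real.exp (-x ^ p)), integral_exp_neg_rpow hp]
  have := Real.Gamma_pos_of_pos (s := 1 / p + 1) (by positivity)
  positivity

theorem expPowConst_pos (hp : 0 < p) : 0 < expPowConst p :=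
  integral_exp_pos (integrable_exp_neg_abs_rpow hp)

theorem expPowDensity_pos (hp : 0 < p) (x : ℝ) : 0 < expPowDensity p x :=
  mul_pos (inv_pos.2 (expPowConst_pos hp)) (Real.exp_pos _)

theorem log_expPowDensity (hp : 0 < p) (x : ℝ) :
    Real.log (expPowDensity p x) = -Real.log (expPowConst p) - |x| ^ p := by
  rw [expPowDensity, Real.log_mul (inv_pos.2 (expPowConst_pos hp)).ne' (Real.exp_pos _).ne',
    Real.log_exp, Real.log_inv, sub_eq_add_neg]

theorem continuous_expPowDensity (hp : 0 ≤ p) : Continuous (expPowDensity p) := by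
  have : Continuous fun x : ℝ => |x| ^ p := continuous_abs.rpow_const fun _ => Or.inr hp
  unfold expPowDensity
  fun_prop

theorem integrable_expPowDensity (hp : 0 < p) : Integrable (expPowDensity p) :=
  (integrable_exp_neg_abs_rpow hp).const_mul _

theorem integral_expPowDensity (hp : 0 < p) : ∫ x, expPowDensity p x = 1 :=
  (integral_const_mul _ _).trans (inv_mul_cancel₀ (expPowConst_pos hp).ne')

theorem expPowDensity_neg (p x : ℝ) : expPowDensity p (-x) = expPowDensity p x := by
  simp only [expPowDensity, abs_neg]

theorem hasDerivAt_expPowDensity (hp : 1 < p) (x : ℝ) :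
    HasDerivAt (expPowDensity p) (-(p * (|x| ^ (p - 2) * x)) * expPowDensity p x) x := by
  convert! ((hasDerivAt_abs_rpow x hp).neg.exp).const_mul (expPowConst p)⁻¹ using 1
  simp only [expPowDensity, Pi.neg_apply]
  ring

theorem locallyAbsolutelyContinuous_expPowDensity (hp : 1 < p) :
    LocallyAbsolutelyContinuous (expPowDensity p) := by
  have : ContDiff ℝ 1 fun x : ℝ => |x| ^ p := by
    simpa only [Real.norm_eq_abs] using contDiff_norm_rpow (E := ℝ) hp
  exact .of_contDiff (contDiff_const.mul this.neg.exp)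

theorem expPowMeasure_eq_withDensity (p : ℝ) : expPowMeasure p =
    volume.withDensity fun x => ENNReal.ofReal (expPowDensity p x) := rfl

theorem integrable_expPowMeasure_iff (hp : 0 < p) {g : ℝ → ℝ} :
    Integrable g (expPowMeasure p) ↔ Integrable fun x => g x * expPowDensity p x := by
  rw [expPowMeasure_eq_withDensity, integrable_withDensity_iff
    (continuous_expPowDensity hp.le).measurable.ennreal_ofReal (by simp)]
  simp only [ENNReal.toReal_ofReal (expPowDensity_pos hp _).le]

theorem integral_expPowMeasure (hp : 0 < p) (g : ℝ → ℝ) :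
    ∫ x, g x ∂expPowMeasure p = ∫ x, g x * expPowDensity p x := by
  rw [expPowMeasure_eq_withDensity, integral_withDensity_eq_integral_toReal_smul
    (continuous_expPowDensity hp.le).measurable.ennreal_ofReal (by simp)]
  simp only [ENNReal.toReal_ofReal (expPowDensity_pos hp _).le, smul_eq_mul, mul_comm]

theorem isProbabilityMeasure_expPowMeasure (hp : 0 < p) :
    IsProbabilityMeasure (expPowMeasure p) := by
  constructor
  rw [expPowMeasure_eq_withDensity, withDensity_apply _ MeasurableSet.univ,
    Measure.restrict_univ, ← ofReal_integral_eq_lintegral_ofReal (integrable_expPowDensity hp)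
      (ae_of_all _ fun x => (expPowDensity_pos hp x).le), integral_expPowDensity hp,
    ENNReal.ofReal_one]

theorem expPowMeasure_absolutelyContinuous (p : ℝ) : expPowMeasure p ≪ volume :=
  withDensity_absolutelyContinuous _ _

theorem expPowDensity_add_le (hp : 1 ≤ p) {x t : ℝ} (hx : 0 ≤ x) (ht : 0 ≤ t) :
    expPowDensity p (t + x) ≤ expPowConst p * expPowDensity p x * expPowDensity p t := by
  have hZ := expPowConst_pos (p := p) (by linarith)
  have hpow : t ^ p + x ^ p ≤ (t + x) ^ p := Real.add_rpow_le_rpow_add ht hx hp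
  simp only [expPowDensity]
  rw [mul_inv_cancel_left₀ hZ.ne', mul_left_comm, ← Real.exp_add, abs_of_nonneg hx,
    abs_of_nonneg ht, abs_of_nonneg (add_nonneg ht hx)]
  gcongr
  linarith

theorem setIntegral_Ioi_expPowDensity_le (hp : 1 ≤ p) {x : ℝ} (hx : 0 ≤ x) :
    ∫ t in Ioi x, expPowDensity p t ≤ expPowConst p * expPowDensity p x := by
  have hp0 : 0 < p := by linarith
  have hZ := expPowConst_pos hp0
  have hρ := expPowDensity_pos hp0
  have hi := integrable_expPowDensity hp0
  calc ∫ t in Ioi x, expPowDensity p t = ∫ t in Ioi 0, expPowDensity p (t + x) := by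
        simpa using ((measurePreserving_add_right volume x).setIntegral_preimage_emb
          (measurableEmbedding_addRight x) (expPowDensity p) (Ioi x)).symm
    _ ≤ ∫ t in Ioi 0, expPowConst p * expPowDensity p x * expPowDensity p t :=
        setIntegral_mono_on (hi.comp_add_right x).integrableOn (hi.const_mul _).integrableOn
          measurableSet_Ioi fun t ht => expPowDensity_add_le hp hx (le_of_lt ht)
    _ ≤ ∫ t, expPowConst p * expPowDensity p x * expPowDensity p t :=
        setIntegral_le_integral (hi.const_mul _)
          (ae_of_all _ fun t => mul_nonneg (mul_nonneg hZ.le (hρ x).le) (hρ t).le)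
    _ = expPowConst p * expPowDensity p x := by
        rw [integral_const_mul, integral_expPowDensity hp0, mul_one]

theorem setIntegral_Iic_expPowDensity_le (hp : 1 ≤ p) {x : ℝ} (hx : x ≤ 0) :
    ∫ t in Iic x, expPowDensity p t ≤ expPowConst p * expPowDensity p x := by
  have hreflect := integral_comp_neg_Iic x (expPowDensity p)
  simp only [expPowDensity_neg] at hreflect
  rw [hreflect, ← expPowDensity_neg p x]
  exact setIntegral_Ioi_expPowDensity_le hp (neg_nonneg.2 hx)

theorem integrable_and_integral_sq_sub_le_expPowMeasure (hp : 1 ≤ p) {f : ℝ → ℝ}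
    (hf : LocallyAbsolutelyContinuous f)
    (hf' : Integrable (fun x => deriv f x ^ 2) (expPowMeasure p)) :
    Integrable (fun x => (f x - f 0) ^ 2) (expPowMeasure p) ∧
      ∫ x, (f x - f 0) ^ 2 ∂expPowMeasure p ≤
        4 * expPowConst p ^ 2 * ∫ x, deriv f x ^ 2 ∂expPowMeasure p := by
  have hp0 : 0 < p := by linarith
  rw [integrable_expPowMeasure_iff hp0, integral_expPowMeasure hp0, integral_expPowMeasure hp0]
  exact integrable_and_integral_sq_sub_mul_le (continuous_expPowDensity hp0.le)
    (integrable_expPowDensity hp0) (fun x => (expPowDensity_pos hp0 x).le)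
    (fun x => setIntegral_Ioi_expPowDensity_le hp) (fun x => setIntegral_Iic_expPowDensity_le hp)
    hf ((integrable_expPowMeasure_iff hp0).1 hf')

theorem memLp_two_expPowMeasure (hp : 1 ≤ p) {f : ℝ → ℝ} (hf : LocallyAbsolutelyContinuous f)
    (hf' : Integrable (fun x => deriv f x ^ 2) (expPowMeasure p)) :
    MemLp f 2 (expPowMeasure p) := by
  have := isProbabilityMeasure_expPowMeasure (p := p) (by linarith)
  have hsub : MemLp (fun x => f x - f 0) 2 (expPowMeasure p) :=
    (memLp_two_iff_integrable_sq (hf.continuous.sub continuous_const).aestronglyMeasurable).2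
      (integrable_and_integral_sq_sub_le_expPowMeasure hp hf hf').1
  simpa only [Pi.add_def, sub_add_cancel] using hsub.add (memLp_const (f 0))

theorem integral_sq_abs_sub_one_le_expPowMeasure (hp : 1 ≤ p) {f : ℝ → ℝ}
    (hf : LocallyAbsolutelyContinuous f) (hf1 : ∫ x, f x ^ 2 ∂expPowMeasure p = 1)
    (hf' : Integrable (fun x => deriv f x ^ 2) (expPowMeasure p)) :
    ∫ x, (|f x| - 1) ^ 2 ∂expPowMeasure p ≤
      8 * expPowConst p ^ 2 * ∫ x, deriv f x ^ 2 ∂expPowMeasure p := by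
  have := isProbabilityMeasure_expPowMeasure (p := p) (by linarith)
  linarith [integral_sq_abs_sub_one_le (memLp_two_expPowMeasure hp hf hf') hf1 (f 0),
    (integrable_and_integral_sq_sub_le_expPowMeasure hp hf hf').2]

end Density

section DefectiveInequality

open InformationTheory

theorem sub_one_le_mul_log {y : ℝ} (hy : 0 ≤ y) : y - 1 ≤ y * Real.log y := by
  linarith [klFun_nonneg hy, klFun_apply y]

theorem integrable_mul_log_of_le {α : Type*} [MeasurableSpace α] {μ : Measure α}
    [IsFiniteMeasure μ] {u G : α → ℝ} (hu : Integrable u μ) (hu0 : ∀ x, 0 ≤ u x)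
    (hG : Integrable G μ) (hle : ∀ x, u x * Real.log (u x) ≤ G x) :
    Integrable (fun x => u x * Real.log (u x)) μ :=
  integrable_of_le_of_le
    (Real.continuous_mul_log.comp_aestronglyMeasurable hu.aestronglyMeasurable)
    (.of_forall fun x => sub_one_le_mul_log (hu0 x)) (.of_forall hle)
    (hu.sub (integrable_const 1)) hG

theorem abs_rpow_le_one_add {a b : ℝ} (ha : 0 ≤ a) (hab : a ≤ b) (x : ℝ) :
    |x| ^ a ≤ 1 + |x| ^ b := by
  rcases le_total |x| 1 with h | h
  · linarith [Real.rpow_le_one (abs_nonneg x) h ha, Real.rpow_nonneg (abs_nonneg x) b]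
  · linarith [Real.rpow_le_rpow_of_exponent_le h hab]

theorem abs_rpow_sub_two_mul_self_mul_self {p : ℝ} (hp : p ≠ 0) (x : ℝ) :
    |x| ^ (p - 2) * x * x = |x| ^ p := by
  rcases eq_or_ne x 0 with rfl | hx
  · simp [hp]
  · rw [Real.rpow_sub (abs_pos.2 hx), Real.rpow_two, mul_assoc, ← pow_two, sq_abs]
    field_simp

theorem abs_abs_rpow_sub_two_mul_self_le {p : ℝ} (hp : 1 ≤ p) (x : ℝ) :
    |(|x| ^ (p - 2) * x)| ≤ 1 + |x| ^ p := by
  rcases eq_or_ne x 0 with rfl | hx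
  · simp only [mul_zero, abs_zero]
    positivity
  · rw [abs_mul, abs_of_nonneg (by positivity : 0 ≤ |x| ^ (p - 2)),
      ← Real.rpow_add_one (abs_pos.2 hx).ne']
    exact abs_rpow_le_one_add (by linarith) (by linarith) x

/-- `K` dominates `|u'| ^ q / (q u ^ (q - 1))`, where `q` is the exponent conjugate to `s`. The
condition is stated as Young's inequality `a |u'| ≤ (a ^ s / s) u + K`, so that it makes sense where
`u` vanishes. -/
def IsYoungMajorant (s : ℝ) (u K : ℝ → ℝ) : Prop :=
  ∀ᵐ x, ∀ a, 0 ≤ a → a * |deriv u x| ≤ a ^ s / s * u x + K x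

variable {p s : ℝ} {u K : ℝ → ℝ}

theorem IsYoungMajorant.nonneg (hK : IsYoungMajorant s u K) (hs : s ≠ 0) : ∀ᵐ x, 0 ≤ K x := by
  filter_upwards [hK] with x hx
  simpa [Real.zero_rpow hs] using hx 0 le_rfl

theorem IsYoungMajorant.abs_deriv_le (hK : IsYoungMajorant s u K) (hs : 1 ≤ s)
    (hu0 : ∀ x, 0 ≤ u x) : ∀ᵐ x, |deriv u x| ≤ u x + K x := by
  filter_upwards [hK] with x hx
  have hx1 := hx 1 zero_le_one
  rw [one_mul, Real.one_rpow, one_div] at hx1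
  linarith [mul_le_of_le_one_left (hu0 x) (inv_le_one_of_one_le₀ hs)]

theorem deriv_mul_expPowDensity (hp : 1 < p) {x : ℝ} (hu : DifferentiableAt ℝ u x) :
    deriv (fun x => u x * expPowDensity p x) x =
      (deriv u x - p * (|x| ^ (p - 2) * x) * u x) * expPowDensity p x := by
  rw [(hu.hasDerivAt.fun_mul (hasDerivAt_expPowDensity hp x)).deriv]
  ring

theorem deriv_self_mul_mul_expPowDensity (hp : 1 < p) {x : ℝ} (hu : DifferentiableAt ℝ u x) :
    deriv (fun x => x * (u x * expPowDensity p x)) x =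
      (u x + x * deriv u x - p * (|x| ^ p * u x)) * expPowDensity p x := by
  have huρ : DifferentiableAt ℝ (fun x => u x * expPowDensity p x) x :=
    hu.mul (hasDerivAt_expPowDensity hp x).differentiableAt
  rw [((hasDerivAt_id' x).fun_mul huρ.hasDerivAt).deriv, deriv_mul_expPowDensity hp hu,
    ← abs_rpow_sub_two_mul_self_mul_self (by linarith : p ≠ 0) x]
  ring

-- Young's inequality with `a = |x|` turns `x u'` into `|x| ^ s u / s ≲ |x| ^ p u / s`, and
-- `s⁻¹ < 1 ≤ p` leaves room to absorb it.
theorem deriv_self_mul_mul_expPowDensity_add_le (hs : 1 < s) (hsp : s ≤ p) {x : ℝ}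
    (hu : DifferentiableAt ℝ u x) (hu0 : 0 ≤ u x)
    (hK : |x| * |deriv u x| ≤ |x| ^ s / s * u x + K x) :
    deriv (fun x => x * (u x * expPowDensity p x)) x
        + (1 - s⁻¹) * (|x| ^ p * u x) * expPowDensity p x
      ≤ (2 * u x + K x) * expPowDensity p x := by
  have hp : 1 < p := hs.trans_le hsp
  have hs1 : s⁻¹ ≤ 1 := inv_le_one_of_one_le₀ hs.le
  have hW : 0 ≤ |x| ^ p * u x := by positivity
  have hyoung : x * deriv u x ≤ s⁻¹ * (|x| ^ p * u x) + u x + K x :=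
    calc x * deriv u x ≤ |x| * |deriv u x| := (le_abs_self _).trans (abs_mul _ _).le
      _ ≤ s⁻¹ * (|x| ^ s * u x) + K x := hK.trans_eq (by ring)
      _ ≤ s⁻¹ * ((1 + |x| ^ p) * u x) + K x := by
          gcongr
          exact abs_rpow_le_one_add (by linarith) hsp x
      _ ≤ s⁻¹ * (|x| ^ p * u x) + u x + K x := by
          linarith [mul_le_of_le_one_left hu0 hs1]
  rw [deriv_self_mul_mul_expPowDensity hp hu, ← add_mul]
  refine mul_le_mul_of_nonneg_right ?_ (expPowDensity_pos (by linarith) x).le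
  linarith [le_mul_of_one_le_left hW hp.le]

theorem integrable_and_integral_abs_rpow_mul_le (hs : 1 < s) (hsp : s ≤ p)
    (hu : LocallyAbsolutelyContinuous u) (hu0 : ∀ x, 0 ≤ u x)
    (hui : Integrable u (expPowMeasure p)) (hKi : Integrable K (expPowMeasure p))
    (hK : IsYoungMajorant s u K) :
    Integrable (fun x => |x| ^ p * u x) (expPowMeasure p) ∧
      (1 - s⁻¹) * ∫ x, |x| ^ p * u x ∂expPowMeasure p ≤
        2 * ∫ x, u x ∂expPowMeasure p + ∫ x, K x ∂expPowMeasure p := by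
  have hp : 1 < p := hs.trans_le hsp
  have hp0 : 0 < p := by linarith
  have hρ := expPowDensity_pos hp0
  have hs1 : 0 < 1 - s⁻¹ := sub_pos.2 (inv_lt_one_of_one_lt₀ hs)
  have huc := hu.continuous
  have hρc := continuous_expPowDensity hp0.le
  have hpc : Continuous fun x : ℝ => |x| ^ p := continuous_abs.rpow_const fun _ => Or.inr hp0.le
  have huρ : LocallyAbsolutelyContinuous fun x => x * (u x * expPowDensity p x) :=
    (LocallyAbsolutelyContinuous.of_contDiff contDiff_id).mul
      (hu.mul (locallyAbsolutelyContinuous_expPowDensity hp))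
  have hderiv : ∀ᵐ x, deriv (fun x => x * (u x * expPowDensity p x)) x
      + (1 - s⁻¹) * (|x| ^ p * u x) * expPowDensity p x ≤
        (2 * u x + K x) * expPowDensity p x := by
    filter_upwards [hu.ae_differentiableAt, hK] with x hx hKx
    exact deriv_self_mul_mul_expPowDensity_add_le hs hsp hx (hu0 x) (hKx _ (abs_nonneg x))
  have hg : Integrable (fun x => 2 * u x + K x) (expPowMeasure p) := (hui.const_mul 2).add hKi
  obtain ⟨hint, hle⟩ := integrable_and_integral_le_of_ae_deriv_add_le huρ
    (fun x hx => by simpa using mul_nonneg hx (mul_nonneg (hu0 x) (hρ x).le)) huρ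
    (fun x hx => by
      simpa using mul_nonpos_of_nonpos_of_nonneg hx (mul_nonneg (hu0 x) (hρ x).le))
    ((integrable_expPowMeasure_iff hp0).1 hg) (by fun_prop)
    (fun x => mul_nonneg (mul_nonneg hs1.le (mul_nonneg (by positivity) (hu0 x))) (hρ x).le)
    (hderiv.mono fun x hx _ => hx) (hderiv.mono fun x hx _ => hx)
  rw [← integral_expPowMeasure hp0, ← integral_expPowMeasure hp0, integral_const_mul,
    integral_add (hui.const_mul 2) hKi, integral_const_mul] at hle
  refine ⟨?_, hle⟩
  simpa [hs1.ne'] using ((integrable_expPowMeasure_iff hp0).2 hint).const_mul (1 - s⁻¹)⁻¹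

theorem IsYoungMajorant.abs_deriv_mul_expPowDensity_le (hK : IsYoungMajorant s u K) (hs : 1 ≤ s)
    (hp : 1 < p) (hu : LocallyAbsolutelyContinuous u) (hu0 : ∀ x, 0 ≤ u x) :
    ∀ᵐ x, |deriv (fun x => u x * expPowDensity p x) x| ≤
      ((1 + p) * u x + K x + p * (|x| ^ p * u x)) * expPowDensity p x := by
  filter_upwards [hu.ae_differentiableAt, hK.abs_deriv_le hs hu0] with x hx hKx
  have hρ := (expPowDensity_pos (by linarith : 0 < p) x).le
  have hdrift : |p * (|x| ^ (p - 2) * x) * u x| ≤ p * (1 + |x| ^ p) * u x := by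
    rw [abs_mul, abs_mul, abs_of_pos (by linarith : 0 < p), abs_of_nonneg (hu0 x)]
    have := hu0 x
    gcongr
    exact abs_abs_rpow_sub_two_mul_self_le hp.le x
  rw [deriv_mul_expPowDensity hp hx, abs_mul, abs_of_nonneg hρ]
  refine mul_le_mul_of_nonneg_right ?_ hρ
  linarith [abs_sub (deriv u x) (p * (|x| ^ (p - 2) * x) * u x)]

theorem mul_expPowDensity_le (hs : 1 ≤ s) (hp : 1 < p)
    (hu : LocallyAbsolutelyContinuous u) (hu0 : ∀ x, 0 ≤ u x)
    (hui : Integrable u (expPowMeasure p)) (hKi : Integrable K (expPowMeasure p))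
    (hWi : Integrable (fun x => |x| ^ p * u x) (expPowMeasure p))
    (hK : IsYoungMajorant s u K) (x : ℝ) :
    u x * expPowDensity p x ≤ (2 + p) * ∫ x, u x ∂expPowMeasure p + ∫ x, K x ∂expPowMeasure p
      + p * ∫ x, |x| ^ p * u x ∂expPowMeasure p := by
  have hp0 : 0 < p := by linarith
  have hρ := expPowDensity_pos hp0
  have huρ := hu.mul (locallyAbsolutelyContinuous_expPowDensity hp)
  have huKi : Integrable (fun x => (1 + p) * u x + K x) (expPowMeasure p) :=
    (hui.const_mul _).add hKi
  have hGi : Integrable (fun x => (1 + p) * u x + K x + p * (|x| ^ p * u x)) (expPowMeasure p) :=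
    huKi.add (hWi.const_mul _)
  have hderiv := hK.abs_deriv_mul_expPowDensity_le hs hp hu hu0
  have hGρ := (integrable_expPowMeasure_iff hp0).1 hGi
  have hderivi : Integrable (deriv fun x => u x * expPowDensity p x) :=
    hGρ.mono' (measurable_deriv _).aestronglyMeasurable hderiv
  calc u x * expPowDensity p x
      ≤ (∫ y, |u y * expPowDensity p y|) + ∫ y, |deriv (fun x => u x * expPowDensity p x) y| :=
        (le_abs_self _).trans (huρ.abs_le_integral_abs_add_integral_abs_deriv
          ((integrable_expPowMeasure_iff hp0).1 hui) hderivi x)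
    _ ≤ (∫ y, u y * expPowDensity p y)
          + ∫ y, ((1 + p) * u y + K y + p * (|y| ^ p * u y)) * expPowDensity p y := by
        refine add_le_add (integral_congr_ae (ae_of_all _ fun y => ?_)).le
          (integral_mono_ae hderivi.abs hGρ hderiv)
        exact abs_of_nonneg (mul_nonneg (hu0 y) (hρ y).le)
    _ = _ := by
        rw [← integral_expPowMeasure hp0, ← integral_expPowMeasure hp0,
          integral_add huKi (hWi.const_mul _),
          integral_add (hui.const_mul _) hKi, integral_const_mul, integral_const_mul]
        ring

theorem mul_log_le_of_mul_expPowDensity_le (hp : 0 < p) {y x M : ℝ} (hy : 0 ≤ y)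
    (hM : y * expPowDensity p x ≤ M) :
    y * Real.log y ≤ (M + |Real.log (expPowConst p)|) * y + |x| ^ p * y := by
  rcases hy.eq_or_lt with rfl | hy
  · simp
  have hρ := expPowDensity_pos hp x
  have hlog : Real.log y + Real.log (expPowDensity p x) ≤ M := by
    rw [← Real.log_mul hy.ne' hρ.ne']
    exact (Real.log_le_self (by positivity)).trans hM
  rw [log_expPowDensity hp] at hlog
  calc y * Real.log y ≤ y * (M + |Real.log (expPowConst p)| + |x| ^ p) := by
        gcongr
        linarith [le_abs_self (Real.log (expPowConst p))]
    _ = _ := by ring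

theorem integrable_and_integral_mul_log_le (hs : 1 < s) (hsp : s ≤ p)
    (hu : LocallyAbsolutelyContinuous u) (hu0 : ∀ x, 0 ≤ u x)
    (hui : Integrable u (expPowMeasure p)) (hu1 : ∫ x, u x ∂expPowMeasure p ≤ 1)
    (hKi : Integrable K (expPowMeasure p)) (hK : IsYoungMajorant s u K) :
    Integrable (fun x => u x * Real.log (u x)) (expPowMeasure p) ∧
      ∫ x, u x * Real.log (u x) ∂expPowMeasure p ≤
        (2 + p + |Real.log (expPowConst p)| + 2 * (p + 1) * (1 - s⁻¹)⁻¹) *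
          (∫ x, u x ∂expPowMeasure p + ∫ x, K x ∂expPowMeasure p) := by
  have hp : 1 < p := hs.trans_le hsp
  have hp0 : 0 < p := by linarith
  have := isProbabilityMeasure_expPowMeasure hp0
  have hs1 : 0 < 1 - s⁻¹ := sub_pos.2 (inv_lt_one_of_one_lt₀ hs)
  obtain ⟨hWi, hW⟩ := integrable_and_integral_abs_rpow_mul_le hs hsp hu hu0 hui hKi hK
  have hsup := mul_expPowDensity_le hs.le hp hu hu0 hui hKi hWi hK
  set U := ∫ x, u x ∂expPowMeasure p
  set k := ∫ x, K x ∂expPowMeasure p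
  set W := ∫ x, |x| ^ p * u x ∂expPowMeasure p
  set L := |Real.log (expPowConst p)|
  set M := (2 + p) * U + k + p * W
  have hU0 : 0 ≤ U := integral_nonneg hu0
  have hk0 : 0 ≤ k := integral_nonneg_of_ae
    ((expPowMeasure_absolutelyContinuous p).ae_le (hK.nonneg (by linarith)))
  have hW0 : 0 ≤ W := integral_nonneg fun x => mul_nonneg (by positivity) (hu0 x)
  have hlog : ∀ x, u x * Real.log (u x) ≤ (M + L) * u x + |x| ^ p * u x := fun x =>
    mul_log_le_of_mul_expPowDensity_le hp0 (hu0 x) (hsup x)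
  have hGi : Integrable (fun x => (M + L) * u x + |x| ^ p * u x) (expPowMeasure p) :=
    (hui.const_mul _).add hWi
  have hi := integrable_mul_log_of_le hui hu0 hGi hlog
  have hWle : W ≤ (1 - s⁻¹)⁻¹ * (2 * (U + k)) := by
    rw [inv_mul_eq_div, le_div_iff₀' hs1]
    linarith
  refine ⟨hi, ?_⟩
  calc ∫ x, u x * Real.log (u x) ∂expPowMeasure p ≤ (M + L) * U + W := by
        refine (integral_mono hi hGi hlog).trans_eq ?_
        rw [integral_add (hui.const_mul _) hWi, integral_const_mul]
    _ ≤ M + L * (U + k) + W := by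
        have : M * U ≤ M := mul_le_of_le_one_right (by positivity) hu1
        have : 0 ≤ L * k := by positivity
        linarith
    _ ≤ (2 + p + L) * (U + k) + (p + 1) * W := by
        have : 0 ≤ (1 + p) * k := by positivity
        linarith
    _ ≤ (2 + p + L) * (U + k) + (p + 1) * ((1 - s⁻¹)⁻¹ * (2 * (U + k))) := by gcongr
    _ = _ := by ring

end DefectiveInequality

section Truncation

open Filter InformationTheory Set

theorem modPow_nonneg (q t : ℝ) : 0 ≤ modPow q t := (sq_nonneg t).trans (le_max_left _ _)

theorem locallyLipschitz_comp_of_contDiffAt {E F G : Type*} [PseudoEMetricSpace E]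
    [NormedAddCommGroup F] [NormedSpace ℝ F] [NormedAddCommGroup G] [NormedSpace ℝ G]
    {g : E → F} {φ : F → G} (hg : LocallyLipschitz g) (hφ : ∀ x, ContDiffAt ℝ 1 φ (g x)) :
    LocallyLipschitz fun x => φ (g x) := by
  intro x
  obtain ⟨K, t, ht, hK⟩ := (hφ x).exists_lipschitzOnWith
  obtain ⟨K', t', ht', hK'⟩ := hg x
  exact ⟨K * K', t' ∩ g ⁻¹' t, inter_mem ht' (hg.continuous.continuousAt ht),
    hK.comp (hK'.mono inter_subset_left) fun y hy => hy.2⟩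

/-- A smooth truncation of the identity, used to discard the region where `f ^ 2` is bounded: it
vanishes for `y ≤ 4` and is asymptotic to `y` for large `y`. The power `q` makes `|T'| ^ q` at most
a multiple of `T ^ (q - 1)` near the threshold. -/
noncomputable def smoothTrunc (q y : ℝ) : ℝ := max y 4 * (1 - 4 / max y 4) ^ q

variable {q y t : ℝ}

theorem one_sub_four_div_nonneg (hy : 4 ≤ y) : 0 ≤ 1 - 4 / y :=
  sub_nonneg.2 ((div_le_one (by linarith)).2 hy)

theorem one_sub_four_div_le_one (hy : 4 ≤ y) : 1 - 4 / y ≤ 1 :=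
  sub_le_self _ (by positivity)

theorem smoothTrunc_of_le (hq : q ≠ 0) (hy : y ≤ 4) : smoothTrunc q y = 0 := by
  simp [smoothTrunc, max_eq_right hy, hq]

theorem smoothTrunc_of_ge (hy : 4 ≤ y) : smoothTrunc q y = y * (1 - 4 / y) ^ q := by
  simp [smoothTrunc, max_eq_left hy]

theorem smoothTrunc_nonneg (q y : ℝ) : 0 ≤ smoothTrunc q y :=
  mul_nonneg (by positivity) (Real.rpow_nonneg (one_sub_four_div_nonneg (le_max_right _ _)) _)

theorem smoothTrunc_le_self (hq : 0 < q) (hy : 0 ≤ y) : smoothTrunc q y ≤ y := by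
  rcases le_total y 4 with h | h
  · rwa [smoothTrunc_of_le hq.ne' h]
  · rw [smoothTrunc_of_ge h]
    exact mul_le_of_le_one_right hy
      (Real.rpow_le_one (one_sub_four_div_nonneg h) (one_sub_four_div_le_one h) hq.le)

theorem smoothTrunc_sq_le (hq : 0 < q) (ht : 0 ≤ t) :
    smoothTrunc q (t ^ 2) ≤ 4 * (t - 1) ^ 2 := by
  rcases le_total t 2 with h | h
  · rw [smoothTrunc_of_le hq.ne' (by nlinarith)]
    positivity
  · exact (smoothTrunc_le_self hq (sq_nonneg t)).trans (by nlinarith)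

theorem locallyLipschitz_smoothTrunc (hq : 1 ≤ q) : LocallyLipschitz (smoothTrunc q) := by
  refine locallyLipschitz_comp_of_contDiffAt (g := fun y => max y 4)
    (φ := fun z => z * (1 - 4 / z) ^ q) (LocallyLipschitz.id.max (LocallyLipschitz.const 4))
    fun y => ?_
  have h4 : max y 4 ≠ 0 := by positivity
  exact contDiffAt_id.mul ((contDiffAt_const.sub (contDiffAt_const.div contDiffAt_id h4))
    |>.rpow_const_of_le (by exact_mod_cast hq))

theorem hasDerivAt_smoothTrunc (hy : 4 < y) :
    HasDerivAt (smoothTrunc q) ((1 - 4 / y) ^ (q - 1) * (1 - 4 / y + 4 * q / y)) y := by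
  have hy0 : y ≠ 0 := by linarith
  have hy4 : y - 4 ≠ 0 := by linarith
  have hw : 0 < 1 - 4 / y := sub_pos.2 ((div_lt_one (by linarith)).2 hy)
  have hderiv : HasDerivAt (fun z : ℝ => z * (1 - 4 / z) ^ q)
      ((1 - 4 / y) ^ (q - 1) * (1 - 4 / y + 4 * q / y)) y := by
    have h := (hasDerivAt_id' y).fun_mul
      ((((hasDerivAt_inv hy0).const_mul 4).const_sub 1).rpow_const (p := q)
        (Or.inl (by simpa only [← div_eq_mul_inv] using hw.ne')))
    simp only [← div_eq_mul_inv] at h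
    convert! h using 1
    rw [Real.rpow_sub_one hw.ne']
    field_simp
  refine hderiv.congr_of_eventuallyEq ?_
  filter_upwards [lt_mem_nhds hy] with z hz using smoothTrunc_of_ge hz.le

theorem div_rpow_mul_smoothTrunc {b : ℝ} (hb : 0 ≤ b) (hy : 4 < y) :
    (b / (1 - 4 / y)) ^ q * smoothTrunc q y = b ^ q * y := by
  have hw : 0 < 1 - 4 / y := sub_pos.2 ((div_lt_one (by linarith)).2 hy)
  rw [smoothTrunc_of_ge hy.le, Real.div_rpow hb hw.le, div_mul_eq_mul_div, ← mul_assoc,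
    mul_div_cancel_right₀ _ (Real.rpow_pos_of_pos hw q).ne']

theorem abs_deriv_smoothTrunc_mul_le (hq : 0 ≤ q) (hy : 4 < y) :
    |deriv (smoothTrunc q) y| * ((1 - 4 / y) * y) ≤ (1 + q) * smoothTrunc q y := by
  have hy0 : 0 < y := by linarith
  have hy4 : y - 4 ≠ 0 := by linarith
  have hw : 0 < 1 - 4 / y := sub_pos.2 ((div_lt_one hy0).2 hy)
  have hfactor : 1 - 4 / y + 4 * q / y ≤ 1 + q := by
    have : 4 * q / y ≤ q := by
      rw [div_le_iff₀ hy0]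
      nlinarith
    linarith [one_sub_four_div_le_one hy.le]
  calc |deriv (smoothTrunc q) y| * ((1 - 4 / y) * y)
      = (1 - 4 / y + 4 * q / y) * (y * (1 - 4 / y) ^ q) := by
        rw [(hasDerivAt_smoothTrunc hy).deriv, abs_of_nonneg (by positivity),
          Real.rpow_sub_one hw.ne']
        field_simp
    _ ≤ (1 + q) * (y * (1 - 4 / y) ^ q) := by gcongr
    _ = (1 + q) * smoothTrunc q y := by rw [smoothTrunc_of_ge hy.le]

theorem neg_sq_sub_one_le_smoothTrunc_mul_log (hq : q ≠ 0) (ht : 0 ≤ t) :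
    -(t - 1) ^ 2 ≤ smoothTrunc q (t ^ 2) * Real.log (smoothTrunc q (t ^ 2)) := by
  rcases le_or_gt t 2 with h | h
  · rw [smoothTrunc_of_le hq (by nlinarith), zero_mul]
    linarith [sq_nonneg (t - 1)]
  · nlinarith [sub_one_le_mul_log (smoothTrunc_nonneg q (t ^ 2)), smoothTrunc_nonneg q (t ^ 2)]

theorem mul_log_le_smoothTrunc_mul_log_add (hq : 0 ≤ q) (hy : 8 ≤ y) :
    y * Real.log y ≤
      2 ^ q * (smoothTrunc q y * (Real.log (smoothTrunc q y) + q)) := by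
  rw [smoothTrunc_of_ge (by linarith : 4 ≤ y)]
  have hy0 : 0 < y := by linarith
  have hw : 1 / 2 ≤ 1 - 4 / y := by
    have : 4 / y ≤ 1 / 2 := by rw [div_le_div_iff₀ hy0 (by norm_num)]; linarith
    linarith
  set w := 1 - 4 / y
  have hw0 : 0 < w := by linarith
  have hlogw : -1 ≤ Real.log w := by
    have : w⁻¹ ≤ 2 := by rw [inv_le_comm₀ hw0 (by norm_num)]; linarith
    linarith [Real.one_sub_inv_le_log_of_pos hw0]
  have hlog : Real.log y ≤ Real.log (y * w ^ q) + q := by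
    rw [Real.log_mul hy0.ne' (by positivity), Real.log_rpow hw0]
    linarith [mul_le_mul_of_nonneg_left hlogw hq]
  have hwq : 1 ≤ 2 ^ q * w ^ q := by
    rw [← Real.mul_rpow zero_le_two hw0.le]
    exact Real.one_le_rpow (by linarith) hq
  calc y * Real.log y
      ≤ 2 ^ q * w ^ q * (y * Real.log y) :=
        le_mul_of_one_le_left (mul_nonneg hy0.le (Real.log_nonneg (by linarith))) hwq
    _ = 2 ^ q * (y * w ^ q * Real.log y) := by ring
    _ ≤ 2 ^ q * (y * w ^ q * (Real.log (y * w ^ q) + q)) := by gcongr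

theorem klFun_le_sq_sub_one (hy : 0 ≤ y) : klFun y ≤ (y - 1) ^ 2 := by
  rw [klFun_apply]
  rcases hy.eq_or_lt with rfl | hy
  · norm_num
  · nlinarith [mul_le_mul_of_nonneg_left (Real.log_le_sub_one_of_pos hy) hy.le]

theorem klFun_sq_le (hq : 0 < q) (ht : 0 ≤ t) :
    klFun (t ^ 2) ≤ 2 ^ q * (smoothTrunc q (t ^ 2) * Real.log (smoothTrunc q (t ^ 2)))
      + (16 + 2 ^ q * (1 + 4 * q)) * (t - 1) ^ 2 := by
  have h2q : (0 : ℝ) < 2 ^ q := by positivity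
  rcases le_total t 3 with h | h
  · have hquad : klFun (t ^ 2) ≤ 16 * (t - 1) ^ 2 :=
      calc klFun (t ^ 2) ≤ (t ^ 2 - 1) ^ 2 := klFun_le_sq_sub_one (sq_nonneg t)
        _ = (t + 1) ^ 2 * (t - 1) ^ 2 := by ring
        _ ≤ 16 * (t - 1) ^ 2 := by gcongr; nlinarith
    have : 0 ≤ 2 ^ q * (4 * q) * (t - 1) ^ 2 := by positivity
    linarith [mul_le_mul_of_nonneg_left (neg_sq_sub_one_le_smoothTrunc_mul_log hq.ne' ht) h2q.le]
  · have hy : 8 ≤ t ^ 2 := by nlinarith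
    have hT : 2 ^ q * q * smoothTrunc q (t ^ 2) ≤ 2 ^ q * q * (4 * (t - 1) ^ 2) := by
      gcongr
      exact smoothTrunc_sq_le hq ht
    have : 0 ≤ 2 ^ q * (t - 1) ^ 2 := by positivity
    rw [klFun_apply]
    linarith [mul_log_le_smoothTrunc_mul_log_add hq.le hy, sq_nonneg (t - 1)]

variable {f : ℝ → ℝ} {x : ℝ}

theorem abs_deriv_smoothTrunc_sq_le (hq : 0 ≤ q) (hf : DifferentiableAt ℝ f x)
    (hfx : 4 < f x ^ 2) :
    |deriv (fun x => smoothTrunc q (f x ^ 2)) x| ≤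
      2 * (1 + q) * |deriv f x / f x| / (1 - 4 / f x ^ 2) * smoothTrunc q (f x ^ 2) := by
  have hw : 0 < 1 - 4 / f x ^ 2 := sub_pos.2 ((div_lt_one (by linarith)).2 hfx)
  have hf0 : f x ≠ 0 := fun h => by norm_num [h] at hfx
  have hchain : deriv (fun x => smoothTrunc q (f x ^ 2)) x =
      deriv (smoothTrunc q) (f x ^ 2) * (2 * (deriv f x / f x) * f x ^ 2) := by
    have hT := (hasDerivAt_smoothTrunc (q := q) hfx).differentiableAt.hasDerivAt
    refine (hT.comp x (hf.hasDerivAt.fun_pow 2)).deriv.trans ?_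
    simp only [Nat.cast_ofNat, Nat.add_one_sub_one, pow_one]
    field_simp
  rw [hchain, div_mul_eq_mul_div, le_div_iff₀ hw]
  calc |deriv (smoothTrunc q) (f x ^ 2) * (2 * (deriv f x / f x) * f x ^ 2)| * (1 - 4 / f x ^ 2)
      = |deriv (smoothTrunc q) (f x ^ 2)| * ((1 - 4 / f x ^ 2) * f x ^ 2)
          * (2 * |deriv f x / f x|) := by
        rw [abs_mul, abs_mul, abs_mul, abs_two, abs_of_nonneg (sq_nonneg (f x))]
        ring
    _ ≤ (1 + q) * smoothTrunc q (f x ^ 2) * (2 * |deriv f x / f x|) := by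
        gcongr ?_ * _
        exact abs_deriv_smoothTrunc_mul_le hq hfx
    _ = _ := by ring

theorem mul_abs_deriv_smoothTrunc_sq_le {s a : ℝ} (hqs : s.HolderConjugate q)
    (hf : DifferentiableAt ℝ f x) (ha : 0 ≤ a) :
    a * |deriv (fun x => smoothTrunc q (f x ^ 2)) x| ≤
      a ^ s / s * smoothTrunc q (f x ^ 2) +
        (2 * (1 + q)) ^ q * (modPow q (deriv f x / f x) * f x ^ 2) := by
  have hq1 : 1 < q := hqs.symm.lt
  have := hqs.pos
  rcases le_or_gt (f x ^ 2) 4 with hfx | hfx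
  · have hT := smoothTrunc_of_le hqs.symm.ne_zero hfx
    have hmin : IsLocalMin (fun x => smoothTrunc q (f x ^ 2)) x :=
      Eventually.of_forall fun y => hT.trans_le (smoothTrunc_nonneg q (f y ^ 2))
    rw [hmin.deriv_eq_zero, hT, abs_zero, mul_zero, mul_zero, zero_add]
    have := modPow_nonneg q (deriv f x / f x)
    positivity
  have hw : 0 < 1 - 4 / f x ^ 2 := sub_pos.2 ((div_lt_one (by linarith)).2 hfx)
  have hT0 := smoothTrunc_nonneg q (f x ^ 2)
  set b := 2 * (1 + q) * |deriv f x / f x| / (1 - 4 / f x ^ 2) with hb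
  have hb0 : 0 ≤ b := by positivity
  have hbT : b ^ q / q * smoothTrunc q (f x ^ 2) ≤
      (2 * (1 + q)) ^ q * (modPow q (deriv f x / f x) * f x ^ 2) :=
    calc b ^ q / q * smoothTrunc q (f x ^ 2)
        ≤ b ^ q * smoothTrunc q (f x ^ 2) := by
          gcongr
          exact div_le_self (by positivity) hq1.le
      _ = (2 * (1 + q)) ^ q * (|deriv f x / f x| ^ q * f x ^ 2) := by
          rw [hb, div_rpow_mul_smoothTrunc (by positivity) hfx,
            Real.mul_rpow (by positivity) (abs_nonneg _), mul_assoc]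
      _ ≤ _ := by
          gcongr
          exact le_max_right _ _
  calc a * |deriv (fun x => smoothTrunc q (f x ^ 2)) x|
      ≤ a * (b * smoothTrunc q (f x ^ 2)) := by
        gcongr
        exact abs_deriv_smoothTrunc_sq_le (by linarith) hf hfx
    _ = a * b * smoothTrunc q (f x ^ 2) := (mul_assoc _ _ _).symm
    _ ≤ (a ^ s / s + b ^ q / q) * smoothTrunc q (f x ^ 2) := by
        gcongr
        exact Real.young_inequality_of_nonneg ha hb0 hqs
    _ ≤ _ := by linarith

end Truncation

section Tightening

open InformationTheory

/-- The integrand of `modEnergy`. -/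
noncomputable def modEnergyDensity (H f : ℝ → ℝ) (x : ℝ) : ℝ := H (deriv f x / f x) * f x ^ 2

variable {H f : ℝ → ℝ} {q s : ℝ} {μ : Measure ℝ}

theorem modEnergyDensity_nonneg (hH : ∀ t, 0 ≤ H t) (f : ℝ → ℝ) (x : ℝ) :
    0 ≤ modEnergyDensity H f x :=
  mul_nonneg (hH _) (sq_nonneg _)

theorem sq_deriv_ae_le_modEnergyDensity (hH : ∀ t, t ^ 2 ≤ H t) (f : ℝ → ℝ) :
    ∀ᵐ x, deriv f x ^ 2 ≤ modEnergyDensity H f x := by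
  filter_upwards [ae_deriv_eq_zero_of_eq f 0] with x hx
  by_cases hfx : f x = 0
  · simp [modEnergyDensity, hx hfx, hfx]
  · calc deriv f x ^ 2 = (deriv f x / f x) ^ 2 * f x ^ 2 := by field_simp
      _ ≤ modEnergyDensity H f x := mul_le_mul_of_nonneg_right (hH _) (sq_nonneg _)

theorem integrable_and_integral_sq_deriv_le (hμ : μ ≪ volume) (hH : ∀ t, t ^ 2 ≤ H t)
    (hE : Integrable (modEnergyDensity H f) μ) :
    Integrable (fun x => deriv f x ^ 2) μ ∧
      ∫ x, deriv f x ^ 2 ∂μ ≤ ∫ x, modEnergyDensity H f x ∂μ := by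
  have hle : ∀ᵐ x ∂μ, deriv f x ^ 2 ≤ modEnergyDensity H f x :=
    hμ.ae_le (sq_deriv_ae_le_modEnergyDensity hH f)
  have hi : Integrable (fun x => deriv f x ^ 2) μ := by
    refine hE.mono' ((measurable_deriv f).pow_const 2).aestronglyMeasurable ?_
    filter_upwards [hle] with x hx
    rwa [Real.norm_of_nonneg (sq_nonneg _)]
  exact ⟨hi, integral_mono_ae hi hE hle⟩

theorem locallyLipschitz_smoothTrunc_sq (hq : 1 ≤ q) (hf : LocallyLipschitz f) :
    LocallyLipschitz fun x => smoothTrunc q (f x ^ 2) :=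
  (locallyLipschitz_smoothTrunc hq).comp
    (locallyLipschitz_comp_of_contDiffAt (φ := fun z => z ^ 2) hf fun _ => by fun_prop)

theorem isYoungMajorant_smoothTrunc_sq (hqs : s.HolderConjugate q)
    (hf : LocallyAbsolutelyContinuous f) :
    IsYoungMajorant s (fun x => smoothTrunc q (f x ^ 2))
      (fun x => (2 * (1 + q)) ^ q * modEnergyDensity (modPow q) f x) := by
  filter_upwards [hf.ae_differentiableAt] with x hx a ha
  exact mul_abs_deriv_smoothTrunc_sq_le hqs hx ha

theorem integrable_smoothTrunc_sq (hq : 1 ≤ q) (hf : LocallyLipschitz f) (hf2 : MemLp f 2 μ) :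
    Integrable (fun x => smoothTrunc q (f x ^ 2)) μ :=
  hf2.integrable_sq.mono'
    (locallyLipschitz_smoothTrunc_sq hq hf).continuous.aestronglyMeasurable
    (.of_forall fun x => by
      rw [Real.norm_of_nonneg (smoothTrunc_nonneg _ _)]
      exact smoothTrunc_le_self (by linarith) (sq_nonneg _))

theorem integrable_sq_abs_sub_one [IsFiniteMeasure μ] (hf2 : MemLp f 2 μ) :
    Integrable (fun x => (|f x| - 1) ^ 2) μ :=
  (hf2.abs.sub (memLp_const 1)).integrable_sq

theorem integral_smoothTrunc_sq_le [IsFiniteMeasure μ] (hq : 1 ≤ q) (hf : LocallyLipschitz f)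
    (hf2 : MemLp f 2 μ) :
    ∫ x, smoothTrunc q (f x ^ 2) ∂μ ≤ 4 * ∫ x, (|f x| - 1) ^ 2 ∂μ := by
  rw [← integral_const_mul]
  refine integral_mono (integrable_smoothTrunc_sq hq hf hf2)
    ((integrable_sq_abs_sub_one hf2).const_mul 4) fun x => ?_
  simpa only [sq_abs] using smoothTrunc_sq_le (by linarith : 0 < q) (abs_nonneg (f x))

theorem integrable_and_integral_sq_mul_log_sq_le [IsProbabilityMeasure μ] (hq : 0 < q)
    (hf2 : MemLp f 2 μ) (hf1 : ∫ x, f x ^ 2 ∂μ = 1)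
    (hT : Integrable (fun x => smoothTrunc q (f x ^ 2) * Real.log (smoothTrunc q (f x ^ 2))) μ) :
    Integrable (fun x => f x ^ 2 * Real.log (f x ^ 2)) μ ∧
      ∫ x, f x ^ 2 * Real.log (f x ^ 2) ∂μ ≤
        2 ^ q * ∫ x, smoothTrunc q (f x ^ 2) * Real.log (smoothTrunc q (f x ^ 2)) ∂μ
          + (16 + 2 ^ q * (1 + 4 * q)) * ∫ x, (|f x| - 1) ^ 2 ∂μ := by
  set B := 16 + 2 ^ q * (1 + 4 * q)
  have hi2 : Integrable (fun x => f x ^ 2) μ := hf2.integrable_sq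
  have hi1 : Integrable (fun x => (|f x| - 1) ^ 2) μ := integrable_sq_abs_sub_one hf2
  have hTB : Integrable (fun x =>
      2 ^ q * (smoothTrunc q (f x ^ 2) * Real.log (smoothTrunc q (f x ^ 2)))
        + B * (|f x| - 1) ^ 2) μ := (hT.const_mul _).add (hi1.const_mul _)
  have hsub : Integrable (fun x => f x ^ 2 - 1) μ := hi2.sub (integrable_const 1)
  have hle : ∀ x, f x ^ 2 * Real.log (f x ^ 2) ≤
      (2 ^ q * (smoothTrunc q (f x ^ 2) * Real.log (smoothTrunc q (f x ^ 2)))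
        + B * (|f x| - 1) ^ 2) + (f x ^ 2 - 1) := fun x => by
    have hklFun := klFun_sq_le hq (abs_nonneg (f x))
    rw [sq_abs, klFun_apply] at hklFun
    linarith
  have hi : Integrable (fun x => f x ^ 2 * Real.log (f x ^ 2)) μ :=
    integrable_mul_log_of_le hi2 (fun x => sq_nonneg _) (hTB.add hsub) hle
  refine ⟨hi, (integral_mono hi (hTB.add hsub) hle).trans_eq ?_⟩
  rw [integral_add' hTB hsub, integral_add (hT.const_mul _) (hi1.const_mul _),
    integral_sub hi2 (integrable_const 1), integral_const_mul, integral_const_mul, hf1]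
  simp

end Tightening

section NormalizedInequality

/-- The modified logarithmic Sobolev inequality for functions normalised in `L ^ 2`, and in terms of
real integrals: homogeneity reduces `ModifiedLogSobolev` to it. -/
def NormalizedModifiedLogSobolev (H : ℝ → ℝ) (μ : Measure ℝ) (C : ℝ) : Prop :=
  ∀ f : ℝ → ℝ, LocallyLipschitz f → ∫ x, f x ^ 2 ∂μ = 1 → Integrable (modEnergyDensity H f) μ →
    Integrable (fun x => f x ^ 2 * Real.log (f x ^ 2)) μ ∧
      ∫ x, f x ^ 2 * Real.log (f x ^ 2) ∂μ ≤ C * ∫ x, modEnergyDensity H f x ∂μ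

theorem exists_normalizedModifiedLogSobolev_expPowMeasure {p q s : ℝ} (hqs : s.HolderConjugate q)
    (hsp : s ≤ p) : ∃ C, NormalizedModifiedLogSobolev (modPow q) (expPowMeasure p) C := by
  have hq : 1 < q := hqs.symm.lt
  have hp : 1 ≤ p := hqs.lt.le.trans hsp
  have := isProbabilityMeasure_expPowMeasure (p := p) (by linarith)
  set μ := expPowMeasure p
  set A := 2 + p + |Real.log (expPowConst p)| + 2 * (p + 1) * (1 - s⁻¹)⁻¹
  have hA : 0 ≤ A := by
    have : 0 ≤ 1 - s⁻¹ := sub_nonneg.2 (inv_le_one_of_one_le₀ hqs.lt.le)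
    positivity
  set V := 8 * expPowConst p ^ 2
  set c := (2 * (1 + q)) ^ q
  set B := 16 + 2 ^ q * (1 + 4 * q)
  refine ⟨2 ^ q * (A * (4 * V + c)) + B * V, fun f hf hf1 hE => ?_⟩
  have hfac := LocallyAbsolutelyContinuous.of_locallyLipschitz hf
  set E := ∫ x, modEnergyDensity (modPow q) f x ∂μ
  obtain ⟨hf'i, hf'⟩ := integrable_and_integral_sq_deriv_le (expPowMeasure_absolutelyContinuous p)
    (H := modPow q) (fun t => le_max_left _ _) hE
  have hf2 : MemLp f 2 μ := memLp_two_expPowMeasure hp hfac hf'i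
  have hvar : ∫ x, (|f x| - 1) ^ 2 ∂μ ≤ V * E :=
    (integral_sq_abs_sub_one_le_expPowMeasure hp hfac hf1 hf'i).trans (by gcongr)
  have hTi : Integrable (fun x => smoothTrunc q (f x ^ 2)) μ :=
    integrable_smoothTrunc_sq hq.le hf hf2
  have hT1 : ∫ x, smoothTrunc q (f x ^ 2) ∂μ ≤ 1 := hf1 ▸ integral_mono hTi hf2.integrable_sq
    fun x => smoothTrunc_le_self (by linarith) (sq_nonneg _)
  obtain ⟨hTlogi, hTlog⟩ := integrable_and_integral_mul_log_le hqs.lt hsp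
    (.of_locallyLipschitz (locallyLipschitz_smoothTrunc_sq hq.le hf))
    (fun x => smoothTrunc_nonneg _ _) hTi hT1 (hE.const_mul c)
    (isYoungMajorant_smoothTrunc_sq hqs hfac)
  rw [integral_const_mul] at hTlog
  obtain ⟨hi, hle⟩ := integrable_and_integral_sq_mul_log_sq_le (by linarith) hf2 hf1 hTlogi
  refine ⟨hi, hle.trans ?_⟩
  calc _ ≤ 2 ^ q * (A * (4 * (V * E) + c * E)) + B * (V * E) := by
        gcongr
        refine hTlog.trans ?_
        gcongr
        exact (integral_smoothTrunc_sq_le hq.le hf hf2).trans (by gcongr)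
    _ = _ := by ring

end NormalizedInequality

section Entropy

variable {μ : Measure ℝ} {H f g : ℝ → ℝ} {C : ℝ}

theorem entropy_eq_of_integrable (hg : Integrable g μ)
    (hgl : Integrable (fun x => g x * Real.log (g x)) μ) :
    entropy μ g = ((∫ x, g x * Real.log (g x) ∂μ) -
      (∫ x, g x ∂μ) * Real.log (∫ x, g x ∂μ) : ℝ) := by
  have hpos : ∫⁻ x, ENNReal.ofReal (g x * Real.log (g x)) ∂μ ≠ ⊤ := hgl.lintegral_lt_top.ne
  have hneg : ∫⁻ x, ENNReal.ofReal (-(g x * Real.log (g x))) ∂μ ≠ ⊤ := hgl.neg.lintegral_lt_top.ne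
  rw [entropy, if_pos hg, integral_eq_lintegral_pos_part_sub_lintegral_neg_part hgl,
    EReal.coe_sub, EReal.coe_sub, EReal.coe_ennreal_toReal hpos, EReal.coe_ennreal_toReal hneg]

theorem entropy_of_ae_eq_zero (hg : g =ᵐ[μ] 0) : entropy μ g = 0 := by
  have hgl : (fun x => g x * Real.log (g x)) =ᵐ[μ] 0 := by
    filter_upwards [hg] with x hx
    simp [hx]
  rw [entropy_eq_of_integrable ((integrable_zero _ _ _).congr hg.symm)
    ((integrable_zero _ _ _).congr hgl.symm), integral_congr_ae hg, integral_congr_ae hgl]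
  simp

theorem entropy_const_mul_of_integral_eq_one (c : ℝ) (hg1 : ∫ x, g x ∂μ = 1)
    (hgl : Integrable (fun x => g x * Real.log (g x)) μ) :
    entropy μ (fun x => c * g x) = (c * ∫ x, g x * Real.log (g x) ∂μ : ℝ) := by
  have hg : Integrable g μ := .of_integral_ne_zero (by simp [hg1])
  have hlog : ∀ x, c * g x * Real.log (c * g x) =
      c * Real.log c * g x + c * (g x * Real.log (g x)) := fun x => by
    have := Real.negMulLog_mul c (g x)
    simp only [Real.negMulLog] at this
    linarith
  have hi : Integrable (fun x => c * g x * Real.log (c * g x)) μ := by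
    simpa only [hlog] using! (hg.const_mul _).add (hgl.const_mul c)
  rw [entropy_eq_of_integrable (hg.const_mul c) hi]
  simp only [hlog]
  rw [integral_add (hg.const_mul _) (hgl.const_mul c), integral_const_mul, integral_const_mul,
    integral_const_mul, hg1]
  ring_nf

theorem entropy_eq_top [IsFiniteMeasure μ] (hg0 : ∀ x, 0 ≤ g x)
    (hgl : ¬ Integrable (fun x => g x * Real.log (g x)) μ) : entropy μ g = ⊤ := by
  unfold entropy
  split_ifs with hg
  · have hneg : ∫⁻ x, ENNReal.ofReal (-(g x * Real.log (g x))) ∂μ ≠ ⊤ := by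
      refine ne_top_of_le_ne_top (measure_ne_top μ Set.univ) ?_
      rw [← lintegral_one]
      refine lintegral_mono fun x => ENNReal.ofReal_le_one.2 ?_
      linarith [sub_one_le_mul_log (hg0 x), hg0 x]
    have hpos : ∫⁻ x, ENNReal.ofReal (g x * Real.log (g x)) ∂μ = ⊤ := by
      by_contra hpos
      refine hgl (integrable_mul_log_of_le hg hg0 (integrable_toReal_of_lintegral_ne_top ?_ hpos)
        fun x => ?_)
      · exact (Real.continuous_mul_log.measurable.comp_aemeasurable hg.aemeasurable).ennreal_ofReal
      · exact (le_max_left _ _).trans_eq ENNReal.toReal_ofReal'.symm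
    rw [hpos, ← EReal.coe_ennreal_toReal hneg]
    rfl
  · rfl

theorem modEnergyDensity_const_mul {c : ℝ} (hc : c ≠ 0) (H f : ℝ → ℝ) (x : ℝ) :
    modEnergyDensity H (fun x => c * f x) x = c ^ 2 * modEnergyDensity H f x := by
  rw [modEnergyDensity, modEnergyDensity, deriv_const_mul_field, mul_div_mul_left _ _ hc]
  ring

theorem measurable_modEnergyDensity (hH : Measurable H) (hf : Measurable f) :
    Measurable (modEnergyDensity H f) :=
  (hH.comp ((measurable_deriv f).div hf)).mul (hf.pow_const 2)

theorem integrable_modEnergyDensity (hH : Measurable H) (hH0 : ∀ t, 0 ≤ H t) (hf : Measurable f)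
    (htop : modEnergy H μ f ≠ ⊤) : Integrable (modEnergyDensity H f) μ := by
  refine ⟨(measurable_modEnergyDensity hH hf).aestronglyMeasurable, ?_⟩
  rw [hasFiniteIntegral_iff_ofReal (.of_forall (modEnergyDensity_nonneg hH0 f))]
  exact htop.lt_top

theorem modEnergy_eq_ofReal_integral (hH0 : ∀ t, 0 ≤ H t)
    (hE : Integrable (modEnergyDensity H f) μ) :
    modEnergy H μ f = ENNReal.ofReal (∫ x, modEnergyDensity H f x ∂μ) :=
  (ofReal_integral_eq_lintegral_ofReal hE (.of_forall (modEnergyDensity_nonneg hH0 f))).symm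

theorem NormalizedModifiedLogSobolev.entropy_sq_le
    (h : NormalizedModifiedLogSobolev H μ C) (hf : LocallyLipschitz f)
    (hf2 : 0 < ∫ x, f x ^ 2 ∂μ) (hE : Integrable (modEnergyDensity H f) μ) :
    entropy μ (fun x => f x ^ 2) ≤ (C * ∫ x, modEnergyDensity H f x ∂μ : ℝ) := by
  set N := ∫ x, f x ^ 2 ∂μ with hN
  have hsqrt : √N⁻¹ ≠ 0 := (Real.sqrt_pos.2 (inv_pos.2 hf2)).ne'
  have hsq : √N⁻¹ ^ 2 = N⁻¹ := Real.sq_sqrt (inv_nonneg.2 hf2.le)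
  have hg : LocallyLipschitz fun x => √N⁻¹ * f x :=
    locallyLipschitz_comp_of_contDiffAt (φ := fun z => √N⁻¹ * z) hf fun _ => by fun_prop
  have hg1 : ∫ x, (√N⁻¹ * f x) ^ 2 ∂μ = 1 := by
    simp only [mul_pow, hsq]
    rw [integral_const_mul, ← hN, inv_mul_cancel₀ hf2.ne']
  have hgE : modEnergyDensity H (fun x => √N⁻¹ * f x) = fun x => N⁻¹ * modEnergyDensity H f x := by
    simp only [funext_iff, modEnergyDensity_const_mul hsqrt, hsq, implies_true]
  obtain ⟨hglog, hgle⟩ := h _ hg hg1 (hgE ▸ hE.const_mul N⁻¹)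
  rw [hgE, integral_const_mul] at hgle
  have hfg : (fun x => f x ^ 2) = fun x => N * (√N⁻¹ * f x) ^ 2 := by
    funext x
    rw [mul_pow, hsq, mul_inv_cancel_left₀ hf2.ne']
  rw [hfg, entropy_const_mul_of_integral_eq_one N hg1 hglog, EReal.coe_le_coe_iff]
  refine (mul_le_mul_of_nonneg_left hgle hf2.le).trans_eq ?_
  rw [mul_left_comm N C, mul_inv_cancel_left₀ hf2.ne']

theorem NormalizedModifiedLogSobolev.modifiedLogSobolev
    (h : NormalizedModifiedLogSobolev H μ C) (hH : Measurable H) (hH0 : ∀ t, 0 ≤ H t)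
    (hL2 : ∀ f : ℝ → ℝ, LocallyLipschitz f → Integrable (modEnergyDensity H f) μ → MemLp f 2 μ) :
    ModifiedLogSobolev H μ := by
  have hκ : 0 < |C| + 1 := by positivity
  refine ⟨|C| + 1, hκ, fun f hf => ?_⟩
  by_cases htop : modEnergy H μ f = ⊤
  · rw [htop, ENNReal.mul_top (ENNReal.ofReal_pos.2 hκ).ne']
    exact le_top
  have hE := integrable_modEnergyDensity hH hH0 hf.continuous.measurable htop
  have hE0 : 0 ≤ ∫ x, modEnergyDensity H f x ∂μ := integral_nonneg (modEnergyDensity_nonneg hH0 f)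
  have hf2 := (hL2 f hf hE).integrable_sq
  rcases (integral_nonneg fun x => sq_nonneg (f x) : 0 ≤ ∫ x, f x ^ 2 ∂μ).eq_or_lt with hN | hN
  · rw [entropy_of_ae_eq_zero
      ((integral_eq_zero_iff_of_nonneg (fun x => sq_nonneg (f x)) hf2).1 hN.symm)]
    exact EReal.coe_ennreal_nonneg _
  rw [modEnergy_eq_ofReal_integral hH0 hE, ← ENNReal.ofReal_mul hκ.le, EReal.coe_ennreal_ofReal,
    max_eq_left (mul_nonneg hκ.le hE0)]
  refine (h.entropy_sq_le hf hN hE).trans (EReal.coe_le_coe_iff.2 ?_)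
  gcongr
  linarith [le_abs_self C]

theorem measurable_modPow (q : ℝ) : Measurable (modPow q) := by
  unfold modPow
  fun_prop

theorem modifiedLogSobolev_expPowMeasure {p q s : ℝ} (hqs : s.HolderConjugate q) (hsp : s ≤ p) :
    ModifiedLogSobolev (modPow q) (expPowMeasure p) := by
  obtain ⟨C, hC⟩ := exists_normalizedModifiedLogSobolev_expPowMeasure hqs hsp
  refine hC.modifiedLogSobolev (measurable_modPow q) (modPow_nonneg q) fun f hf hE => ?_
  exact memLp_two_expPowMeasure (hqs.lt.le.trans hsp) (.of_locallyLipschitz hf)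
    (integrable_and_integral_sq_deriv_le (expPowMeasure_absolutelyContinuous p)
      (fun t => le_max_left _ _) hE).1

end Entropy

section Counterexample

open Set Topology

/-- The function witnessing the failure of the inequality for small `p`: on `(1, ∞)` its square has
density `x ^ (-(1 + p)) / Z_p` with respect to Lebesgue measure when weighted by `expPowMeasure p`,
so that it is square integrable but has infinite entropy. -/
noncomputable def edgeFun (p x : ℝ) : ℝ :=
  Real.exp ((max x 1 ^ p - (1 + p) * Real.log (max x 1)) / 2)

variable {p q x : ℝ}

theorem locallyLipschitz_edgeFun (p : ℝ) : LocallyLipschitz (edgeFun p) := by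
  refine locallyLipschitz_comp_of_contDiffAt (g := fun x => max x 1)
    (φ := fun z => Real.exp ((z ^ p - (1 + p) * Real.log z) / 2))
    (LocallyLipschitz.id.max (LocallyLipschitz.const 1)) fun x => ?_
  have h1 : max x 1 ≠ 0 := by positivity
  exact (((contDiffAt_id.rpow_const_of_ne h1).sub
    (contDiffAt_const.mul (contDiffAt_id.log h1))).div_const 2).exp

theorem edgeFun_sq (hx : 1 ≤ x) :
    edgeFun p x ^ 2 = Real.exp (x ^ p - (1 + p) * Real.log x) := by
  rw [edgeFun, max_eq_left hx, ← Real.exp_nat_mul, Nat.cast_ofNat, mul_div_cancel₀ _ two_ne_zero]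

theorem edgeFun_sq_mul_expPowDensity (hx : 1 ≤ x) :
    edgeFun p x ^ 2 * expPowDensity p x = (expPowConst p)⁻¹ * x ^ (-(1 + p)) := by
  have hx0 : 0 < x := by linarith
  rw [edgeFun_sq hx, expPowDensity, abs_of_pos hx0, mul_left_comm, ← Real.exp_add,
    Real.rpow_def_of_pos hx0 (-(1 + p))]
  congr 2
  ring

theorem deriv_edgeFun_div_edgeFun (hx : 1 < x) :
    deriv (edgeFun p) x / edgeFun p x = (p * x ^ (p - 1) - (1 + p) * x⁻¹) / 2 := by
  have hx0 : x ≠ 0 := by linarith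
  have heq : edgeFun p =ᶠ[𝓝 x] fun z => Real.exp ((z ^ p - (1 + p) * Real.log z) / 2) := by
    filter_upwards [lt_mem_nhds hx] with z hz
    rw [edgeFun, max_eq_left hz.le]
  have hderiv := (((Real.hasDerivAt_rpow_const (p := p) (Or.inl hx0)).sub
    ((Real.hasDerivAt_log hx0).const_mul (1 + p))).div_const 2).exp
  rw [(hderiv.congr_of_eventuallyEq heq).deriv, heq.eq_of_nhds]
  exact mul_div_cancel_left₀ _ (Real.exp_pos _).ne'

theorem deriv_edgeFun_of_lt (hx : x < 1) : deriv (edgeFun p) x = 0 := by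
  have heq : edgeFun p =ᶠ[𝓝 x] fun _ => Real.exp ((1 ^ p - (1 + p) * Real.log 1) / 2) := by
    filter_upwards [gt_mem_nhds hx] with z hz
    rw [edgeFun, max_eq_right hz.le]
  rw [heq.deriv_eq, deriv_const]

theorem abs_deriv_edgeFun_div_edgeFun_le (hp : 0 ≤ p) (hx : 1 < x) :
    |deriv (edgeFun p) x / edgeFun p x| ≤ (1 + p) * x ^ max (p - 1) 0 := by
  have hpow : x ^ (p - 1) ≤ x ^ max (p - 1) 0 :=
    Real.rpow_le_rpow_of_exponent_le hx.le (le_max_left _ _)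
  have hpow0 : 0 < x ^ (p - 1) := by positivity
  have hpow1 : 1 ≤ x ^ max (p - 1) 0 := Real.one_le_rpow hx.le (le_max_right _ _)
  have hinv : x⁻¹ ≤ 1 := inv_le_one_of_one_le₀ hx.le
  have hinv0 : 0 < x⁻¹ := by positivity
  rw [deriv_edgeFun_div_edgeFun hx, abs_le]
  constructor <;> nlinarith

theorem modPow_le_rpow {b t : ℝ} (hq : 2 ≤ q) (hb : 1 ≤ b) (ht : |t| ≤ b) :
    modPow q t ≤ b ^ q := by
  refine max_le ?_ (Real.rpow_le_rpow (abs_nonneg _) ht (by linarith))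
  calc t ^ 2 ≤ b ^ 2 := sq_le_sq.2 (ht.trans (le_abs_self b))
    _ = b ^ (2 : ℝ) := (Real.rpow_two b).symm
    _ ≤ b ^ q := Real.rpow_le_rpow_of_exponent_le hb hq

theorem modEnergyDensity_edgeFun_of_lt (hq : q ≠ 0) (hx : x < 1) :
    modEnergyDensity (modPow q) (edgeFun p) x = 0 := by
  simp [modEnergyDensity, modPow, deriv_edgeFun_of_lt hx, Real.zero_rpow hq]

theorem modEnergyDensity_edgeFun_mul_expPowDensity_le (hq : 2 ≤ q) (hp : 0 < p) (hx : 1 < x) :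
    modEnergyDensity (modPow q) (edgeFun p) x * expPowDensity p x ≤
      (1 + p) ^ q * (expPowConst p)⁻¹ * x ^ (max (p - 1) 0 * q - (1 + p)) := by
  have hx0 : 0 < x := by linarith
  have hZ := expPowConst_pos hp
  have hb : 1 ≤ (1 + p) * x ^ max (p - 1) 0 :=
    one_le_mul_of_one_le_of_one_le (by linarith) (Real.one_le_rpow hx.le (le_max_right _ _))
  calc modEnergyDensity (modPow q) (edgeFun p) x * expPowDensity p x
      = modPow q (deriv (edgeFun p) x / edgeFun p x) *
          ((expPowConst p)⁻¹ * x ^ (-(1 + p))) := by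
        rw [modEnergyDensity, mul_assoc, edgeFun_sq_mul_expPowDensity hx.le]
    _ ≤ ((1 + p) * x ^ max (p - 1) 0) ^ q * ((expPowConst p)⁻¹ * x ^ (-(1 + p))) := by
        gcongr
        exact modPow_le_rpow hq hb (abs_deriv_edgeFun_div_edgeFun_le hp.le hx)
    _ = _ := by
        rw [Real.mul_rpow (by linarith) (by positivity), ← Real.rpow_mul hx0.le,
          sub_eq_add_neg (max (p - 1) 0 * q), Real.rpow_add hx0]
        ring

theorem integrable_modEnergyDensity_edgeFun (hq : 2 ≤ q) (hp : 0 < p) (hpq : (p - 1) * q < p) :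
    Integrable (modEnergyDensity (modPow q) (edgeFun p)) (expPowMeasure p) := by
  have hexp : max (p - 1) 0 * q - (1 + p) < -1 := by
    rcases max_choice (p - 1) 0 with h | h <;> rw [h] <;> linarith
  have hdom : Integrable ((Ioi (1 : ℝ)).indicator fun x =>
      (1 + p) ^ q * (expPowConst p)⁻¹ * x ^ (max (p - 1) 0 * q - (1 + p))) :=
    (integrable_indicator_iff measurableSet_Ioi).2
      ((integrableOn_Ioi_rpow_of_lt hexp one_pos).const_mul _)
  refine (integrable_expPowMeasure_iff hp).2 (hdom.mono' ((measurable_modEnergyDensity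
    (measurable_modPow q) (locallyLipschitz_edgeFun p).continuous.measurable).mul
      (continuous_expPowDensity hp.le).measurable).aestronglyMeasurable ?_)
  filter_upwards [Measure.ae_ne volume (1 : ℝ)] with x hx1
  rcases lt_or_gt_of_ne hx1 with hx | hx
  · rw [modEnergyDensity_edgeFun_of_lt (by linarith) hx, zero_mul, norm_zero,
      indicator_of_notMem (notMem_Ioi.2 hx.le)]
  · rw [indicator_of_mem (mem_Ioi.2 hx), Real.norm_of_nonneg
      (mul_nonneg (modEnergyDensity_nonneg (modPow_nonneg q) _ x) (expPowDensity_pos hp x).le)]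
    exact modEnergyDensity_edgeFun_mul_expPowDensity_le hq hp hx

theorem inv_le_edgeFun_sq_mul_log_mul_expPowDensity_add (hp : 0 < p) (hx : 1 ≤ x) :
    x⁻¹ ≤ expPowConst p * (edgeFun p x ^ 2 * Real.log (edgeFun p x ^ 2) * expPowDensity p x)
      + (1 + p) / (p / 2) * x ^ (-(1 + p / 2)) := by
  have hx0 : 0 < x := by linarith
  have hlog : Real.log x ≤ x ^ (p / 2) / (p / 2) := Real.log_le_rpow_div hx0.le (by positivity)
  have hentropy :
      expPowConst p * (edgeFun p x ^ 2 * Real.log (edgeFun p x ^ 2) * expPowDensity p x) =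
        (x ^ p - (1 + p) * Real.log x) * x ^ (-(1 + p)) := by
    rw [mul_right_comm, edgeFun_sq_mul_expPowDensity hx, edgeFun_sq hx, Real.log_exp, mul_assoc,
      mul_inv_cancel_left₀ (expPowConst_pos hp).ne', mul_comm]
  have hinv : x⁻¹ = x ^ p * x ^ (-(1 + p)) := by
    rw [← Real.rpow_add hx0, ← Real.rpow_neg_one]
    ring_nf
  have hsplit : x ^ (-(1 + p / 2)) = x ^ (p / 2) * x ^ (-(1 + p)) := by
    rw [← Real.rpow_add hx0]
    ring_nf
  have hlog_mul : (1 + p) * Real.log x * x ^ (-(1 + p)) ≤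
      (1 + p) * (x ^ (p / 2) / (p / 2)) * x ^ (-(1 + p)) := by gcongr
  rw [hentropy, hinv, hsplit]
  linear_combination hlog_mul

theorem not_integrable_edgeFun_sq_mul_log (hp : 0 < p) :
    ¬ Integrable (fun x => edgeFun p x ^ 2 * Real.log (edgeFun p x ^ 2)) (expPowMeasure p) := by
  intro h
  have hpow : IntegrableOn (fun x : ℝ => x ^ (-(1 + p / 2))) (Ioi 1) :=
    integrableOn_Ioi_rpow_of_lt (by linarith) one_pos
  refine not_integrableOn_Ioi_inv (a := (1 : ℝ))
    (((((integrable_expPowMeasure_iff hp).1 h).integrableOn.const_mul (expPowConst p)).add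
      (hpow.const_mul ((1 + p) / (p / 2)))).mono' measurable_inv.aestronglyMeasurable ?_)
  filter_upwards [ae_restrict_mem measurableSet_Ioi] with x hx
  rw [Real.norm_of_nonneg (inv_nonneg.2 (by linarith [mem_Ioi.1 hx]))]
  exact inv_le_edgeFun_sq_mul_log_mul_expPowDensity_add hp (le_of_lt hx)

theorem not_modifiedLogSobolev_expPowMeasure (hq : 2 ≤ q) (hp : 0 < p) (hpq : (p - 1) * q < p) :
    ¬ ModifiedLogSobolev (modPow q) (expPowMeasure p) := by
  rintro ⟨κ, -, hκ⟩
  have := isProbabilityMeasure_expPowMeasure hp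
  have hle := hκ _ (locallyLipschitz_edgeFun p)
  rw [entropy_eq_top (fun x => sq_nonneg _) (not_integrable_edgeFun_sq_mul_log hp), top_le_iff,
    EReal.coe_ennreal_eq_top_iff] at hle
  refine ENNReal.mul_ne_top ENNReal.ofReal_ne_top ?_ hle
  rw [modEnergy_eq_ofReal_integral (modPow_nonneg q)
    (integrable_modEnergyDensity_edgeFun hq hp hpq)]
  exact ENNReal.ofReal_ne_top

end Counterexample

theorem mainTheorem5_general (q qs p : ℝ) (hq : 2 ≤ q) (hqs : 1 / q + 1 / qs = 1) (hp : 0 < p) :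
    ModifiedLogSobolev (modPow q) (expPowMeasure p) ↔ qs ≤ p := by
  have hconj : q.HolderConjugate qs := Real.holderConjugate_iff.2
    ⟨by linarith, by simpa only [one_div] using hqs⟩
  refine ⟨fun h => ?_, modifiedLogSobolev_expPowMeasure hconj.symm⟩
  by_contra! hlt
  refine not_modifiedLogSobolev_expPowMeasure hq hp ?_ h
  have hsub : 0 < q - 1 := sub_pos.2 hconj.lt
  calc (p - 1) * q = p + (p * (q - 1) - q) := by ring
    _ < p + (qs * (q - 1) - q) := by gcongr
    _ = p := by rw [mul_comm, hconj.sub_one_mul_conj, sub_self, add_zero]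

theorem mainTheorem5 (q qs p : ℝ) (hq : 2 ≤ q) (hqs : 1 / q + 1 / qs = 1) (hp : 1 ≤ p) :
    ModifiedLogSobolev (modPow q) (expPowMeasure p) ↔ qs ≤ p :=
  mainTheorem5_general q qs p hq hqs (by linarith)
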